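/- Let $R$ be an associative ring with unit and let $T$ be a right $R$-module that is $1$-tilting, that is: $T$ has projective dimension at most $1$; $\mathrm{Ext}^i_R(T,T^{(\lambda)})=0$ for all $i\ge 1$ and all cardinals $\lambda$; and there is an exact sequence $0\to R\to T_0'\to T_1'\to 0$ of right $R$-modules with $T_0',T_1'$ direct summands of direct sums of copies of $T$. Assume moreover that there is an exact sequence $0\to R\to T\to T_1\to 0$ with $T_1$ (isomorphic to) a direct summand of $T$. Let $(\mathcal T,\mathcal F)$ be the tilting torsion pair of $T$: $\mathcal T$ is the class of all quotients of direct sums of copies of $T$ and $\mathcal F=\{M\in \mathrm{Mod}\text{-}R\mid \mathrm{Hom}_R(T,M)=0\}$. Let $S=\mathrm{End}_R(T)$, so that $T$ is an $S$-$R$-bimodule, let $W$ be an injective cogenerator of $\mathrm{Mod}\text{-}R$, and let $T^d=\mathrm{Hom}_R(T,W)$, a right $S$-module. Let $\mathcal F_{T^d}$ be the class of right $S$-modules that embed in a direct product of copies of $T^d$, and let $\mathcal T_{T^d}=\{N\in \mathrm{Mod}\text{-}S\mid \mathrm{Hom}_S(N,T^d)=0\}$. Put \[\mathcal E={}_\perp\{T^d\}=\{N\in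 \mathrm{Mod}\text{-}S\mid \mathrm{Hom}_S(N,T^d)=0=\mathrm{Ext}^1_S(N,T^d)\},\] \[\mathcal M=\mathcal E_\perp=\{M\in \mathrm{Mod}\text{-}S\mid \mathrm{Hom}_S(N,M)=0=\mathrm{Ext}^1_S(N,M)\text{ for all }N\in\mathcal E\},\] and regard $\mathcal Y=\mathcal F_{T^d}\cap\mathcal M$ and $\mathcal X=\mathcal T_{T^d}\cap\mathcal M$ as full subcategories of $\mathrm{Mod}\text{-}S$, and $\mathcal T$, $\mathcal F$ as full subcategories of $\mathrm{Mod}\text{-}R$. Then: (1) $\mathrm{Hom}_R(T,-)$ maps $\mathcal T$ into $\mathcal Y$, $-\otimes_S T$ maps $\mathcal Y$ into $\mathcal T$, and these functors restrict to mutually inverse equivalences between $\mathcal T$ and $\mathcal Y$. (2) $\mathrm{Ext}^1_R(T,-)$ maps $\mathcal F$ into $\mathcal X$, $\mathrm{Tor}_1^S(-,T)$ maps $\mathcal X$ into $\mathcal F$, and these functors restrict to mutually inverse equivalences between $\mathcal F$ and $\mathcal X$. -/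

import Mathlib

open CategoryTheory CategoryTheory.Abelian CategoryTheory.Limits MulOpposite
open scoped TensorProduct

universe u

noncomputable section

namespace BrennerButler

/-- The category of right modules over a ring `A` (left modules over the opposite ring). -/
abbrev RMod (A : Type u) [Ring A] : Type (u + 1) := ModuleCat.{u} Aᵐᵒᵖ

/-! ### Tilting modules -/

section Tilting

variable {A : Type u} [Ring A]

/-- The direct sum `M^(ι)` of `ι` copies of `M`. -/
abbrev copower (M : RMod A) (ι : Type u) : RMod A := ModuleCat.of Aᵐᵒᵖ (ι →₀ M)

/-- The direct product `M^ι` of `ι` copies of `M`. -/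
abbrev power (M : RMod A) (ι : Type u) : RMod A := ModuleCat.of Aᵐᵒᵖ (ι → M)

/-- `X` is isomorphic to a direct summand of `M`. -/
def IsSummand (X M : RMod A) : Prop :=
  ∃ (i : X ⟶ M) (p : M ⟶ X), i ≫ p = 𝟙 X

/-- `Add T`: the direct summands of arbitrary direct sums of copies of `T`. -/
def Add (T : RMod A) : ObjectProperty (RMod A) :=
  fun M => ∃ ι : Type u, IsSummand M (copower T ι)

/-- `0 ⟶ A ⟶ X₀ ⟶ X₁ ⟶ 0` is an exact sequence of right `A`-modules for some choice of the maps,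
where `A` is the regular right module. -/
def HasCoresolution (X₀ X₁ : RMod A) : Prop :=
  ∃ (f : A →ₗ[Aᵐᵒᵖ] X₀) (g : X₀ →ₗ[Aᵐᵒᵖ] X₁),
    Function.Injective f ∧ Function.Exact f g ∧ Function.Surjective g

/-- `1`-tilting right modules (not necessarily finitely generated). -/
structure IsOneTilting (T : RMod A) : Prop where
  /-- the projective dimension of `T` is at most `1` -/
  projDim : HasProjectiveDimensionLE T 1
  /-- `Ext^i(T, T^(ι)) = 0` for all `i ≥ 1` and all sets `ι` -/
  ext_zero : ∀ (ι : Type u) (i : ℕ), 1 ≤ i → Subsingleton (Ext T (copower T ι) i)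
  /-- there is an exact sequence `0 ⟶ A ⟶ T₀ ⟶ T₁ ⟶ 0` with `T₀`, `T₁` in `Add T` -/
  coresolution : ∃ T₀ T₁ : RMod A, Add T T₀ ∧ Add T T₁ ∧ HasCoresolution T₀ T₁

/-- There is an exact sequence `0 ⟶ A ⟶ T ⟶ T₁ ⟶ 0` with `T₁` a direct summand of `T`. -/
def IsNormalized (T : RMod A) : Prop :=
  ∃ T₁ : RMod A, IsSummand T₁ T ∧ HasCoresolution T T₁

/-- `Gen T`: the modules that are quotients of direct sums of copies of `T`.
This is the torsion class of the torsion pair of a `1`-tilting module `T`. -/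
def Gen (T : RMod A) : ObjectProperty (RMod A) :=
  fun M => ∃ (ι : Type u) (f : copower T ι ⟶ M), Function.Surjective f.hom

/-- `Ker Hom(T, -)`.
This is the torsion-free class of the torsion pair of a `1`-tilting module `T`. -/
def KerHomFrom (T : RMod A) : ObjectProperty (RMod A) :=
  fun M => ∀ f : T ⟶ M, f = 0

/-- `Cogen C`: the modules that embed in a direct product of copies of `C`. -/
def Cogen (C : RMod A) : ObjectProperty (RMod A) :=
  fun M => ∃ (ι : Type u) (f : M ⟶ power C ι), Function.Injective f.hom

/-- `Ker Hom(-, C)`. -/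
def KerHomTo (C : RMod A) : ObjectProperty (RMod A) :=
  fun M => ∀ f : M ⟶ C, f = 0

/-- The right perpendicular category of a class `P`:
the modules `M` with `Hom(P, M) = 0 = Ext¹(P, M)`. -/
def rightPerp (P : ObjectProperty (RMod A)) : ObjectProperty (RMod A) :=
  fun M => ∀ N, P N → (∀ f : N ⟶ M, f = 0) ∧ Subsingleton (Ext N M 1)

/-- The left perpendicular category of a class `P`:
the modules `N` with `Hom(N, P) = 0 = Ext¹(N, P)`. -/
def leftPerp (P : ObjectProperty (RMod A)) : ObjectProperty (RMod A) :=
  fun N => ∀ M, P M → (∀ f : N ⟶ M, f = 0) ∧ Subsingleton (Ext N M 1)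

end Tilting

/-! ### The four functors

Throughout, `S = End T`, with multiplication the composition of endomorphisms (`s * t` is
`s` after `t`), so that `T` is a left `S`-module. -/

section Functors

variable {R : Type u} [Ring R] (T : RMod R)

/-- `Hom_R(T, -)`, with `S = End T` acting on the right by precomposition. -/
abbrev homFunctor : RMod R ⥤ RMod (End T) := preadditiveCoyonedaObj T

/-- The right action of `End X` on `Ext^n(X, Y)` given by functoriality in `X`. -/
instance extModule (X Y : RMod R) (n : ℕ) : Module (End X)ᵐᵒᵖ (Ext X Y n) where
  smul s x := (Ext.mk₀ (s.unop : X ⟶ X)).comp x (zero_add n)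
  one_smul x := Ext.mk₀_id_comp x
  mul_smul s t x := (Ext.mk₀_comp_mk₀_assoc (s.unop : X ⟶ X) (t.unop : X ⟶ X) x).symm
  smul_zero _ := Ext.comp_zero _ _ _ _ _
  smul_add _ _ _ := Ext.comp_add _ _ _ _
  add_smul s t x := by
    change (Ext.mk₀ ((s.unop : X ⟶ X) + (t.unop : X ⟶ X))).comp x (zero_add n) = _
    rw [Ext.mk₀_add, Ext.add_comp]
    rfl
  zero_smul x := by
    change (Ext.mk₀ (0 : X ⟶ X)).comp x (zero_add n) = _
    rw [Ext.mk₀_zero, Ext.zero_comp]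

/-- `Ext¹_R(T, -)`, with its right action of `S = End T`. -/
def ext1Functor : RMod R ⥤ RMod (End T) where
  obj M := ModuleCat.of _ (Ext T M 1)
  map f := ModuleCat.ofHom
    { toFun := fun x => x.comp (Ext.mk₀ f) (add_zero 1)
      map_add' := fun _ _ => Ext.add_comp _ _ _ _
      map_smul' := fun _ _ => Ext.comp_assoc _ _ _ (zero_add 1) (add_zero 1) rfl }
  map_id M := by
    ext x
    exact Ext.comp_mk₀_id (X := T) (Y := M) x
  map_comp f g := by
    ext x
    change Ext.comp x (Ext.mk₀ (f ≫ g)) (add_zero 1) =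
      Ext.comp (Ext.comp x (Ext.mk₀ f) (add_zero 1)) (Ext.mk₀ g) (add_zero 1)
    rw [← Ext.mk₀_comp_mk₀, Ext.comp_assoc_of_third_deg_zero]

/-- The relations `s t ⊗ n = t ⊗ n s` defining `N ⊗_S T` as a quotient of `T ⊗_ℤ N`. -/
def tensorRel (N : RMod (End T)) : Submodule Rᵐᵒᵖ (T ⊗[ℤ] N) :=
  Submodule.span Rᵐᵒᵖ
    {z | ∃ (s : End T) (t : T) (n : N),
      z = (ConcreteCategory.hom (s : T ⟶ T) t) ⊗ₜ[ℤ] n - t ⊗ₜ[ℤ] (op s • n)}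

theorem tensorRel_le_comap {N N' : RMod (End T)} (f : N ⟶ N') :
    tensorRel T N ≤ (tensorRel T N').comap
      (TensorProduct.AlgebraTensorModule.lTensor Rᵐᵒᵖ T (f.hom.restrictScalars ℤ)) := by
  refine Submodule.span_le.2 ?_
  rintro _ ⟨s, t, n, rfl⟩
  refine Submodule.subset_span ⟨s, t, f.hom n, ?_⟩
  simp

/-- The underlying `R`-module of `N ⊗_S T`, where `S = End T`: the quotient of `T ⊗_ℤ N` by the
relations `s t ⊗ n = t ⊗ n s`, with `R` acting on the factor `T`. -/
abbrev TensorObj (N : RMod (End T)) : Type u := (T ⊗[ℤ] N) ⧸ tensorRel T N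

/-- The map `N ⊗_S T ⟶ N' ⊗_S T` induced by `f : N ⟶ N'`. -/
def tensorMap {N N' : RMod (End T)} (f : N ⟶ N') : TensorObj T N →ₗ[Rᵐᵒᵖ] TensorObj T N' :=
  Submodule.mapQ _ _ _ (tensorRel_le_comap T f)

theorem tensorMap_mk {N N' : RMod (End T)} (f : N ⟶ N') (t : T) (n : N) :
    tensorMap T f ((tensorRel T N).mkQ (t ⊗ₜ[ℤ] n)) =
      (tensorRel T N').mkQ (t ⊗ₜ[ℤ] f.hom n) := by
  simp [tensorMap]

theorem tensorObj_hom_ext {N : RMod (End T)} {M : Type*} [AddCommGroup M] [Module Rᵐᵒᵖ M]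
    {f g : TensorObj T N →ₗ[Rᵐᵒᵖ] M}
    (h : ∀ (t : T) (n : N), f ((tensorRel T N).mkQ (t ⊗ₜ[ℤ] n)) =
      g ((tensorRel T N).mkQ (t ⊗ₜ[ℤ] n))) : f = g := by
  refine LinearMap.ext fun x => ?_
  obtain ⟨x, rfl⟩ := Submodule.mkQ_surjective _ x
  induction x using TensorProduct.induction_on with
  | zero => rw [map_zero, map_zero, map_zero]
  | tmul t n => exact h t n
  | add x y hx hy => rw [map_add, map_add, map_add, hx, hy]

/-- The functor `- ⊗_S T` from right `S`-modules to right `R`-modules, where `S = End T`. -/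
def tensorFunctor : RMod (End T) ⥤ RMod R where
  obj N := ModuleCat.of Rᵐᵒᵖ (TensorObj T N)
  map f := ModuleCat.ofHom (tensorMap T f)
  map_id N := ModuleCat.hom_ext <| tensorObj_hom_ext T fun t n => tensorMap_mk T (𝟙 N) t n
  map_comp f g := ModuleCat.hom_ext <| tensorObj_hom_ext T fun t n => by
    simp only [ModuleCat.hom_comp, ModuleCat.hom_ofHom, LinearMap.comp_apply, tensorMap_mk]

instance tensorFunctor_additive : (tensorFunctor T).Additive where
  map_add {N N' f g} := ModuleCat.hom_ext <| tensorObj_hom_ext T fun t n => by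
    change tensorMap T (f + g) _ = tensorMap T f _ + tensorMap T g _
    simp only [tensorMap_mk, ModuleCat.hom_add, LinearMap.add_apply, TensorProduct.tmul_add,
      map_add]

/-- `Tor₁^S(-, T)`, where `S = End T`: the first left derived functor of `- ⊗_S T`. -/
def tor1Functor : RMod (End T) ⥤ RMod R := (tensorFunctor T).leftDerived 1

end Functors

/-! ### The classes of right `End T`-modules -/

section Classes

variable {R : Type u} [Ring R] (T W : RMod R)

/-- The dual `T^d = Hom_R(T, W)`, a right module over `S = End T`. -/
abbrev dual : RMod (End T) := (homFunctor T).obj W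

/-- `ℰ`, the left perpendicular category of `{T^d}`. -/
def classE : ObjectProperty (RMod (End T)) := leftPerp (.singleton (dual T W))

/-- `ℳ`, the right perpendicular category of `ℰ`. -/
def classM : ObjectProperty (RMod (End T)) := rightPerp (classE T W)

/-- `𝒴`, the intersection of `Cogen T^d` and `ℳ`. -/
def classY : ObjectProperty (RMod (End T)) :=
  fun N => Cogen (dual T W) N ∧ classM T W N

/-- `𝒳`, the intersection of `Ker Hom(-, T^d)` and `ℳ`. -/
def classX : ObjectProperty (RMod (End T)) :=
  fun N => KerHomTo (dual T W) N ∧ classM T W N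

end Classes

/-- `F` maps `P` into `Q`, `G` maps `Q` into `P`, and the restrictions of `F` and `G` are
mutually inverse equivalences between the full subcategories `P` and `Q`. -/
def InverseEquivalences {C D : Type*} [Category* C] [Category* D]
    (P : ObjectProperty C) (Q : ObjectProperty D) (F : C ⥤ D) (G : D ⥤ C) : Prop :=
  ∃ (hF : ∀ X, P X → Q (F.obj X)) (hG : ∀ Y, Q Y → P (G.obj Y))
    (e : P.FullSubcategory ≌ Q.FullSubcategory),
    e.functor = Q.lift (P.ι ⋙ F) (fun X => hF X.obj X.property) ∧
    e.inverse = P.lift (Q.ι ⋙ G) (fun Y => hG Y.obj Y.property)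

end BrennerButler

end

-- Apply `Hom_R(-, T)` to `0 → R → T → T₁ → 0`. As `T₁` is a summand of `T`, cut out by an
-- idempotent `e`, this presents `T` as a left `S`-module: `0 → S e → S → T → 0`, where `1 ∈ S` goes
-- to the image `t₀` of `1 ∈ R` and the kernel is `S γ`. Hence `N ⊗_S T = N / N γ` and `Tor₁(N, T) =
-- {n ∈ N e | n γ = 0}` for every right `S`-module `N`, so the proof can compute with elements
-- (`TiltingData`, `tmk_eq_zero_iff`, `IsTor`).
--
-- Since `W` cogenerates, `ℰ` consists of the `N` with `N ⊗ T = 0 = Tor₁(N, T)` (`classE_iff`).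
-- Therefore `ℳ` contains every `Hom(T, X)`, and `Ext¹(T, X)` for `X ∈ ℱ` (`classM_hom`,
-- `classM_ext`). The recurring device is `surjective_of_cokernel_classE`: an injection of a module
-- of `ℳ` into a module receiving no nonzero map from `ℰ` is an isomorphism once its cokernel is in
-- `ℰ`, because it splits.
--
-- (1) The counit is bijective on `𝒯` because every element of `X ∈ 𝒯` is `f(t₀)` for some `f : T →
-- X`. For `N ∈ 𝒴` the unit `N → Hom(T, N ⊗ T)` is injective since `T^d` cogenerates `N`, and the
-- device applies to it.
--
-- (2) A connecting map identifies `X ∈ ℱ` with `Tor₁(Ext¹(T, X), T)`. For `N ∈ 𝒳` and `0 → K → P →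
-- N → 0` with `P` projective, the sequence `0 → Tor₁(N, T) → K ⊗ T → P ⊗ T → 0` is exact, and the
-- units induce `N → Ext¹(T, Tor₁(N, T))`. What could go wrong is measured by `coneHomology`, which
-- lies in `ℰ` and so has no nonzero map to `N`; the device then gives an isomorphism. Faithfulness
-- of `Tor₁` on `𝒳` (`hom_eq_zero_of_isTor`) turns these isomorphisms into an equivalence.

noncomputable section

namespace BrennerButler

-- The regular right module

section Regular

variable {A : Type u} [Ring A]

/-- The right regular module. -/
abbrev regular (A : Type u) [Ring A] : RMod A := ModuleCat.of Aᵐᵒᵖ A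

/-- The homomorphism from the regular module sending `1` to `x`. -/
def fromRegular {X : RMod A} (x : X) : regular A ⟶ X :=
  ModuleCat.ofHom
    { toFun := fun a => op a • x
      map_add' := fun a b => by rw [MulOpposite.op_add, add_smul]
      map_smul' := fun r a => by
        change op (a * r.unop) • x = r • op a • x
        rw [MulOpposite.op_mul, MulOpposite.op_unop, mul_smul] }

theorem regular_hom_ext {X : RMod A} {f g : regular A ⟶ X} (h : f.hom (1 : A) = g.hom (1 : A)) :
    f = g := by
  refine ModuleCat.hom_ext (LinearMap.ext fun a => ?_)
  have ha : a = op a • (1 : A) := by simp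
  rw [ha]
  exact (map_smul _ _ _).trans ((congrArg _ h).trans (map_smul _ _ _).symm)

instance projective_regular : Projective (regular A) where
  factors f g _ := by
    obtain ⟨y, hy⟩ := (ModuleCat.epi_iff_surjective g).1 inferInstance (f.hom (1 : A))
    refine ⟨fromRegular y, regular_hom_ext ?_⟩
    change g.hom (op (1 : A) • y) = _
    rw [MulOpposite.op_one, one_smul]
    exact hy

end Regular

-- Elements of right `End T`-modules

section Action

variable {R : Type u} [Ring R] {T : RMod R}

/-- The right action of an endomorphism of `T` on an element of a right `End T`-module. -/
def act {N : RMod (End T)} (n : N) (s : T ⟶ T) : N := (op s : (End T)ᵐᵒᵖ) • n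

scoped infixl:73 " ◃ " => act

section

variable {N N' : RMod (End T)} (n m : N) (s t : T ⟶ T)

@[simp] theorem act_add : (n + m) ◃ s = n ◃ s + m ◃ s := smul_add _ _ _
@[simp] theorem act_sub : (n - m) ◃ s = n ◃ s - m ◃ s := smul_sub _ _ _
@[simp] theorem act_neg : (-n) ◃ s = -(n ◃ s) := smul_neg _ _
@[simp] theorem act_zero : (0 : N) ◃ s = 0 := smul_zero _
@[simp] theorem act_zero_right : n ◃ (0 : T ⟶ T) = 0 := zero_smul (End T)ᵐᵒᵖ n
@[simp] theorem act_id : n ◃ 𝟙 T = n := one_smul (End T)ᵐᵒᵖ n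
theorem act_act : n ◃ s ◃ t = n ◃ (t ≫ s) := (mul_smul (op t : (End T)ᵐᵒᵖ) (op s) n).symm
theorem act_add_right : n ◃ (s + t) = n ◃ s + n ◃ t := add_smul (op s : (End T)ᵐᵒᵖ) (op t) n
theorem act_sub_right : n ◃ (s - t) = n ◃ s - n ◃ t := sub_smul (op s : (End T)ᵐᵒᵖ) (op t) n

@[simp] theorem map_act (f : N ⟶ N') : f.hom (n ◃ s) = f.hom n ◃ s := map_smul f.hom _ _

end

/-- The elements of `homFunctor T` are the morphisms from `T`. -/
def ofHom {X : RMod R} : (T ⟶ X) ≃+ (homFunctor T).obj X := AddEquiv.refl _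

theorem homFunctor_map_ofHom {X Y : RMod R} (g : X ⟶ Y) (f : T ⟶ X) :
    ((homFunctor T).map g).hom (ofHom f) = ofHom (f ≫ g) := rfl

/-- Evaluation of an element of `homFunctor T`. -/
def ev {X : RMod R} : (homFunctor T).obj X →+ (T →ₗ[Rᵐᵒᵖ] X) :=
  (ModuleCat.homAddEquiv (M := T) (N := X)).toAddMonoidHom

@[simp]
theorem ev_act {X : RMod R} (f : (homFunctor T).obj X) (s : T ⟶ T) (t : T) :
    ev (f ◃ s) t = ev f (s.hom t) := rfl

@[simp]
theorem ev_map {X Y : RMod R} (g : X ⟶ Y) (f : (homFunctor T).obj X) (t : T) :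
    ev (((homFunctor T).map g).hom f) t = g.hom (ev f t) := rfl

theorem ev_ext {X : RMod R} {f g : (homFunctor T).obj X} (h : ∀ t, ev f t = ev g t) : f = g :=
  ModuleCat.hom_ext (LinearMap.ext h)

/-- The elements of `ext1Functor T` are the elements of `Ext¹(T, -)`. -/
def ofExt {X : RMod R} : Ext T X 1 ≃+ (ext1Functor T).obj X := AddEquiv.refl _

theorem ofExt_act {X : RMod R} (x : Ext T X 1) (s : T ⟶ T) :
    ofExt x ◃ s = ofExt ((Ext.mk₀ s).comp x (zero_add 1)) := rfl

theorem ext1Functor_map_ofExt {X Y : RMod R} (f : X ⟶ Y) (x : Ext T X 1) :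
    ((ext1Functor T).map f).hom (ofExt x) = ofExt (x.comp (Ext.mk₀ f) (add_zero 1)) := rfl

end Action

-- Lifting and extending maps when `Ext¹` vanishes

section Ext

universe w v

variable {C : Type v} [Category.{u} C] [Abelian C] [HasExt.{w} C]

theorem exists_lift_of_ext {S : ShortComplex C} (hS : S.ShortExact) {X : C}
    (h : Subsingleton (Ext X S.X₁ 1)) (f : X ⟶ S.X₃) : ∃ f' : X ⟶ S.X₂, f' ≫ S.g = f := by
  obtain ⟨y, hy⟩ := Ext.covariant_sequence_exact₃ X hS (Ext.mk₀ f) (zero_add 1)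
    (Subsingleton.elim _ _)
  obtain ⟨f', rfl⟩ := (Ext.mk₀_bijective X S.X₂).2 y
  exact ⟨f', (Ext.mk₀_bijective _ _).1 (by rw [← hy, Ext.mk₀_comp_mk₀])⟩

theorem exists_extension_of_ext {S : ShortComplex C} (hS : S.ShortExact) {Y : C}
    (h : Subsingleton (Ext S.X₃ Y 1)) (f : S.X₁ ⟶ Y) : ∃ f' : S.X₂ ⟶ Y, S.f ≫ f' = f := by
  obtain ⟨y, hy⟩ := Ext.contravariant_sequence_exact₁ hS Y (Ext.mk₀ f) (add_zero 1)
    (Subsingleton.elim _ _)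
  obtain ⟨f', rfl⟩ := (Ext.mk₀_bijective S.X₂ Y).2 y
  exact ⟨f', (Ext.mk₀_bijective _ _).1 (by rw [← hy, Ext.mk₀_comp_mk₀])⟩

theorem ext_one_subsingleton_of_extension {S : ShortComplex C} (hS : S.ShortExact) {Y : C}
    (h₂ : Subsingleton (Ext S.X₂ Y 1)) (h : ∀ f : S.X₁ ⟶ Y, ∃ f' : S.X₂ ⟶ Y, S.f ≫ f' = f) :
    Subsingleton (Ext S.X₃ Y 1) := by
  refine subsingleton_of_forall_eq 0 fun x => ?_
  obtain ⟨y, rfl⟩ := Ext.contravariant_sequence_exact₃ hS Y x (Subsingleton.elim _ _) (add_zero 1)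
  obtain ⟨f, rfl⟩ := (Ext.mk₀_bijective S.X₁ Y).2 y
  obtain ⟨f', rfl⟩ := h f
  rw [← Ext.mk₀_comp_mk₀, hS.extClass_comp_assoc]

end Ext

-- The presentation of `T` over `End T`

section TiltingData

variable {R : Type u} [Ring R] {T : RMod R}

/-- Given `t₀ : T` and endomorphisms `e`, `γ` of `T`, the pair `(s, c)` lifts the action of `r`
on `T` to an endomorphism of the presentation of `T` by free `End T`-modules. -/
structure LiftsScalar (t₀ : T) (e γ : T ⟶ T) (r : Rᵐᵒᵖ) (s c : T ⟶ T) : Prop where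
  apply_eq : s.hom t₀ = r • t₀
  comm : γ ≫ c = s ≫ γ
  left_fixed : e ≫ c = c
  right_fixed : c ≫ e = c

/-- `θ` identifies `X` with `Tor₁(N, T)`, computed from the presentation of `T` given by
`t₀`, `e` and `γ`. -/
structure IsTor (t₀ : T) (e γ : T ⟶ T) {X : RMod R} {N : RMod (End T)} (θ : X →+ N) : Prop where
  injective : Function.Injective θ
  fixed : ∀ x, θ x ◃ e = θ x
  act_eq_zero : ∀ x, θ x ◃ γ = 0
  exists_eq : ∀ n : N, n ◃ e = n → n ◃ γ = 0 → ∃ x, θ x = n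
  map_smul : ∀ {r s c}, LiftsScalar t₀ e γ r s c → ∀ x, θ (r • x) = θ x ◃ c

/-- The element `t₀` generates `T` over `End T`, and its annihilator is `(End T) γ ≅ (End T) e`;
moreover `T` behaves like a normalized tilting module. -/
structure TiltingData (t₀ : T) (e γ : T ⟶ T) : Prop where
  apply_eq_zero : γ.hom t₀ = 0
  idem : e ≫ e = e
  comp_idem : γ ≫ e = γ
  exists_factor : ∀ {X : RMod R} (f : T ⟶ X), f.hom t₀ = 0 → ∃ h, f = γ ≫ h
  comp_eq_zero : ∀ {X : RMod R} (f : T ⟶ X), γ ≫ f = 0 → e ≫ f = 0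
  exists_apply_eq : ∀ {X : RMod R}, Gen T X → ∀ x : X, ∃ f : T ⟶ X, f.hom t₀ = x
  ext_subsingleton : ∀ {X : RMod R}, Gen T X → Subsingleton (Ext T X 1)
  ext_eq_act : ∀ {X : RMod R} (x : (ext1Functor T).obj X), ∃ y, x = y ◃ γ
  exists_isTor_ext : ∃ δ : ∀ X : RMod R, X →+ (ext1Functor T).obj X,
    (∀ X, KerHomFrom T X → IsTor t₀ e γ (δ X)) ∧
    ∀ {X Y : RMod R} (f : X ⟶ Y) (x : X), δ Y (f.hom x) = ((ext1Functor T).map f).hom (δ X x)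

theorem gen_self (T : RMod R) : Gen T T :=
  ⟨PUnit, ModuleCat.ofHom (Finsupp.lapply PUnit.unit), fun t =>
    ⟨Finsupp.single PUnit.unit t, by simp⟩⟩

theorem IsSummand.ext_subsingleton {X M Y : RMod R} (h : IsSummand X M)
    (hM : Subsingleton (Ext M Y 1)) : Subsingleton (Ext X Y 1) := by
  obtain ⟨i, p, hip⟩ := h
  refine subsingleton_of_forall_eq 0 fun x => ?_
  have : x = (Ext.mk₀ i).comp ((Ext.mk₀ p).comp x (zero_add 1)) (zero_add 1) := by
    rw [Ext.mk₀_comp_mk₀_assoc, hip, Ext.mk₀_id_comp]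
  rw [this, Subsingleton.elim ((Ext.mk₀ p).comp x (zero_add 1)) 0, Ext.comp_zero]

/-- Projective dimension at most `1` kills `Ext²(T, ker f)`, so the vanishing of `Ext¹(T, T^(ι))`
passes to quotients. -/
theorem ext_subsingleton_of_gen (hT : IsOneTilting T) {X : RMod R} (hX : Gen T X) :
    Subsingleton (Ext T X 1) := by
  obtain ⟨ι, f, hf⟩ := hX
  have : Epi f := (ModuleCat.epi_iff_surjective f).2 hf
  have hS : (ShortComplex.mk (kernel.ι f) f (kernel.condition f)).ShortExact :=
    { exact := ShortComplex.exact_kernel f }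
  have := hT.projDim
  refine subsingleton_of_forall_eq 0 fun x => ?_
  have := HasProjectiveDimensionLT.subsingleton T 2 2 le_rfl (kernel f)
  obtain ⟨y, rfl⟩ := Ext.covariant_sequence_exact₃ T hS x rfl (Subsingleton.elim _ _)
  have := hT.ext_zero ι 1 le_rfl
  rw [Subsingleton.elim y 0, Ext.zero_comp]

theorem fromRegular_add {X : RMod R} (x y : X) :
    fromRegular (x + y) = fromRegular x + fromRegular y :=
  regular_hom_ext (smul_add _ _ _)

theorem fromRegular_comp {X Y : RMod R} (x : X) (f : X ⟶ Y) :
    fromRegular x ≫ f = fromRegular (f.hom x) :=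
  regular_hom_ext (_root_.map_smul f.hom _ _)

theorem fromRegular_hom_one {X : RMod R} (f : regular R ⟶ X) :
    fromRegular (f.hom (1 : R)) = f := by
  refine regular_hom_ext ?_
  change op (1 : R) • f.hom (1 : R) = _
  rw [MulOpposite.op_one, one_smul]

/-- The connecting map `X ≅ Hom(R, X) ⟶ Ext¹(T₁, X)` of a short exact sequence
`0 ⟶ R ⟶ T ⟶ T₁ ⟶ 0`, followed by the map to `Ext¹(T, X)` induced by `p : T ⟶ T₁`. -/
def connecting {S : ShortComplex (RMod R)} (hS : S.ShortExact) (hR : S.X₁ = regular R)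
    (p : T ⟶ S.X₃) (X : RMod R) : X →+ (ext1Functor T).obj X where
  toFun x := ofExt ((Ext.mk₀ p).comp (hS.extClass.comp (Ext.mk₀ (eqToHom hR ≫ fromRegular x))
    (add_zero 1)) (zero_add 1))
  map_zero' := by
    have : fromRegular (0 : X) = 0 := regular_hom_ext (smul_zero _)
    rw [this, Limits.comp_zero, Ext.mk₀_zero, Ext.comp_zero, Ext.comp_zero,
      map_zero]
  map_add' x y := by
    rw [fromRegular_add, Preadditive.comp_add, Ext.mk₀_add, Ext.comp_add, Ext.comp_add,
      map_add]

theorem exists_tiltingData (hT : IsOneTilting T) (hN : IsNormalized T) :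
    ∃ (t₀ : T) (e γ : T ⟶ T), TiltingData t₀ e γ := by
  obtain ⟨T₁, hT₁, f, g, hf, hfg, hg⟩ := hN
  obtain ⟨i, p, hip⟩ := id hT₁
  let F : regular R ⟶ T := ModuleCat.ofHom f
  let G : T ⟶ T₁ := ModuleCat.ofHom g
  have hFG : F ≫ G = 0 := ModuleCat.hom_ext (LinearMap.ext fun a => hfg.apply_apply_eq_zero a)
  have hepi : Epi G := (ModuleCat.epi_iff_surjective G).2 hg
  have hmono : Mono F := (ModuleCat.mono_iff_injective F).2 hf
  have hS : (ShortComplex.mk F G hFG).ShortExact :=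
    { exact := (ShortComplex.ShortExact.moduleCat_exact_iff_function_exact _).2 hfg }
  have hker : ∀ {X : RMod R} (f : T ⟶ X), f.hom (F.hom (1 : R)) = 0 → ∃ h, G ≫ h = f := by
    intro X f hf
    have hFf : F ≫ f = 0 := regular_hom_ext hf
    exact ⟨hS.exact.desc f hFf, hS.exact.g_desc f hFf⟩
  have hext₁ : ∀ {X : RMod R}, Gen T X → Subsingleton (Ext T₁ X 1) := fun hX =>
    hT₁.ext_subsingleton (ext_subsingleton_of_gen hT hX)
  have hGF : G.hom (F.hom (1 : R)) = 0 := hfg.apply_apply_eq_zero (1 : R)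
  -- `e` projects `T` onto `T₁`, and `γ` is `T → T₁ → T`; a map killing `t₀` factors through `G`,
  -- hence through `γ`.
  refine ⟨F.hom (1 : R), p ≫ i, G ≫ i, ?_⟩
  constructor
  · change i.hom (G.hom (F.hom (1 : R))) = 0
    rw [hGF, map_zero]
  · simp [reassoc_of% hip]
  · simp [reassoc_of% hip]
  · intro X f hf
    obtain ⟨h, rfl⟩ := hker f hf
    exact ⟨p ≫ h, by simp [reassoc_of% hip]⟩
  · intro X f hf
    rw [Category.assoc] at hf ⊢
    rw [Limits.zero_of_epi_comp G hf, Limits.comp_zero]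
  · intro X hX x
    obtain ⟨f, hf⟩ := exists_extension_of_ext hS (hext₁ hX) (fromRegular x)
    refine ⟨f, ?_⟩
    have := congrArg (fun k : regular R ⟶ X => k.hom (1 : R)) hf
    refine this.trans ?_
    change op (1 : R) • x = x
    rw [MulOpposite.op_one, one_smul]
  · exact fun hX => ext_subsingleton_of_gen hT hX
  · intro X x
    obtain ⟨x, rfl⟩ := ofExt.surjective x
    -- `Ext¹(R, X) = 0`, so `Ext¹(T₁, X) → Ext¹(T, X)` is onto.
    obtain ⟨y, hy⟩ := Ext.contravariant_sequence_exact₂ hS X x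
      (Ext.eq_zero_of_projective (P := regular R) _)
    refine ⟨ofExt ((Ext.mk₀ p).comp y (zero_add 1)), ?_⟩
    rw [ofExt_act, Ext.mk₀_comp_mk₀_assoc, Category.assoc, hip, Category.comp_id]
    exact congrArg ofExt hy.symm
  · have key : ∀ (X : RMod R) (x : X), connecting hS rfl p X x = ofExt ((Ext.mk₀ p).comp
        (hS.extClass.comp (Ext.mk₀ (fromRegular x)) (add_zero 1)) (zero_add 1)) := by
      intro X x
      change ofExt ((Ext.mk₀ p).comp (hS.extClass.comp (Ext.mk₀ (𝟙 _ ≫ fromRegular x))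
        (add_zero 1)) (zero_add 1)) = _
      rw [Category.id_comp]
    refine ⟨connecting hS rfl p, fun X hX => ?_, fun {X Y} f x => ?_⟩
    -- Everything is read off `0 = Hom(T, X) → X → Ext¹(T₁, X) → Ext¹(T, X)`, where `p` identifies
    -- `Ext¹(T₁, X)` with the `e`-fixed part of `Ext¹(T, X)`.
    · constructor
      · rw [injective_iff_map_eq_zero]
        intro x hx
        rw [key, EmbeddingLike.map_eq_zero_iff] at hx
        have h₁ : hS.extClass.comp (Ext.mk₀ (fromRegular x)) (add_zero 1) = 0 := by
          have := congrArg (fun z => (Ext.mk₀ i).comp z (zero_add 1)) hx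
          dsimp only at this
          rw [Ext.mk₀_comp_mk₀_assoc, hip, Ext.mk₀_id_comp] at this
          exact this.trans (Ext.comp_zero _ _ _ _ _)
        obtain ⟨y, hy⟩ := Ext.contravariant_sequence_exact₁ hS X _ _ h₁
        obtain ⟨y, rfl⟩ := (Ext.mk₀_bijective T X).2 y
        rw [hX y, Ext.mk₀_zero, Ext.comp_zero] at hy
        have hx0 : fromRegular x = 0 :=
          (Ext.mk₀_bijective _ _).1 (hy.symm.trans (Ext.mk₀_zero _ _).symm)
        have := congrArg (fun k : regular R ⟶ X => k.hom (1 : R)) hx0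
        change op (1 : R) • x = 0 at this
        rwa [MulOpposite.op_one, one_smul] at this
      · intro x
        rw [key, ofExt_act, Ext.mk₀_comp_mk₀_assoc, Category.assoc, hip, Category.comp_id]
      · intro x
        rw [key, ofExt_act, Ext.mk₀_comp_mk₀_assoc, Category.assoc, hip, Category.comp_id,
          EmbeddingLike.map_eq_zero_iff]
        exact hS.comp_extClass_assoc _ _
      · intro n hne hnγ
        obtain ⟨n, rfl⟩ := ofExt.surjective n
        rw [ofExt_act, EmbeddingLike.apply_eq_iff_eq] at hne
        rw [ofExt_act, EmbeddingLike.map_eq_zero_iff] at hnγ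
        have h₁ : (Ext.mk₀ G).comp ((Ext.mk₀ i).comp n (zero_add 1)) (zero_add 1)
            = 0 := by
          rw [Ext.mk₀_comp_mk₀_assoc]; exact hnγ
        obtain ⟨y, hy⟩ := Ext.contravariant_sequence_exact₃ hS X _ h₁ (add_zero 1)
        obtain ⟨y, rfl⟩ := (Ext.mk₀_bijective (regular R) X).2 y
        refine ⟨y.hom (1 : R), ?_⟩
        rw [key, fromRegular_hom_one]
        refine congrArg ofExt
          ((congrArg (fun z => (Ext.mk₀ p).comp z (zero_add 1)) hy).trans ?_)
        rw [Ext.mk₀_comp_mk₀_assoc]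
        exact hne
      · intro r s c h x
        rw [key, key, ofExt_act, Ext.mk₀_comp_mk₀_assoc]
        have hpc : c ≫ p = p ≫ (i ≫ c ≫ p) := by
          have := congrArg (· ≫ p) h.left_fixed
          simpa using this.symm
        -- Left multiplication by `r` on `R` extends to an endomorphism of the whole sequence;
        -- naturality of the extension class then moves `r` across to `c`.
        let φ : ShortComplex.mk F G hFG ⟶ ShortComplex.mk F G hFG :=
          { τ₁ := fromRegular (X := regular R) (r.unop : R)
            τ₂ := s
            τ₃ := i ≫ c ≫ p
            comm₁₂ := by
              refine regular_hom_ext ?_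
              change F.hom (op (1 : R) • (r.unop : R)) = s.hom (F.hom (1 : R))
              rw [h.apply_eq]
              refine Eq.trans ?_ (_root_.map_smul F.hom r (1 : R))
              congr 1
              change r.unop * 1 = 1 * r.unop
              rw [mul_one, one_mul]
            comm₂₃ := by
              have := congrArg (· ≫ p) h.comm
              simpa [hip] using this.symm }
        have hφ := ShortComplex.ShortExact.extClass_naturality hS hS φ
        have hx : fromRegular (r • x) = fromRegular (X := regular R) (r.unop : R) ≫
            fromRegular x := by
          refine regular_hom_ext ?_
          change op (1 : R) • r • x = op (r.unop * 1) • x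
          simp
        have hσ : hS.extClass.comp (Ext.mk₀ (fromRegular (r • x))) (add_zero 1) =
            (Ext.mk₀ (i ≫ c ≫ p)).comp
              (hS.extClass.comp (Ext.mk₀ (fromRegular x)) (add_zero 1)) (zero_add 1) := by
          rw [hx, ← Ext.mk₀_comp_mk₀, ← Ext.comp_assoc_of_third_deg_zero]
          refine (congrArg (fun z => z.comp (Ext.mk₀ (fromRegular x)) (add_zero 1)) hφ).trans ?_
          exact Ext.comp_assoc_of_third_deg_zero _ _ _ _
        rw [hσ, Ext.mk₀_comp_mk₀_assoc, ← hpc]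
    · rw [key, key, ← fromRegular_comp, ← Ext.mk₀_comp_mk₀, ext1Functor_map_ofExt,
        Ext.comp_assoc_of_third_deg_zero, Ext.comp_assoc_of_third_deg_zero]

end TiltingData

-- The tensor-hom adjunction

section Tensor

variable {R : Type u} [Ring R] {T : RMod R}

/-- The pure tensors in `N ⊗_S T`. -/
def tmk {N : RMod (End T)} (t : T) : N →+ TensorObj T N where
  toFun n := (tensorRel T N).mkQ (t ⊗ₜ[ℤ] n)
  map_zero' := by rw [TensorProduct.tmul_zero, map_zero]
  map_add' n m := by rw [TensorProduct.tmul_add, map_add]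

section

variable {N N' : RMod (End T)}

theorem tmk_add_left (t t' : T) (n : N) : tmk (t + t') n = tmk t n + tmk t' n := by
  change (tensorRel T N).mkQ _ = (tensorRel T N).mkQ _ + (tensorRel T N).mkQ _
  rw [TensorProduct.add_tmul, map_add]

theorem smul_tmk (r : Rᵐᵒᵖ) (t : T) (n : N) : r • tmk t n = tmk (r • t) n := by
  change r • (tensorRel T N).mkQ _ = (tensorRel T N).mkQ _
  rw [← map_smul]
  rfl

theorem tmk_apply_left (s : T ⟶ T) (t : T) (n : N) : tmk (s.hom t) n = tmk t (n ◃ s) := by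
  rw [← sub_eq_zero]
  change (tensorRel T N).mkQ _ - (tensorRel T N).mkQ _ = 0
  rw [← map_sub, Submodule.mkQ_apply, Submodule.Quotient.mk_eq_zero]
  exact Submodule.subset_span ⟨s, t, n, rfl⟩

theorem tensorFunctor_map_tmk (f : N ⟶ N') (t : T) (n : N) :
    ((tensorFunctor T).map f).hom (tmk t n) = tmk t (f.hom n) := tensorMap_mk T f t n

/-- The additive map underlying `tensorLift`, on the tensor product over `ℤ`. -/
def intTensorLift {X : RMod R} (φ : N ⟶ (homFunctor T).obj X) : T ⊗[ℤ] N →+ X :=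
  TensorProduct.liftAddHom (((LinearMap.toAddMonoidHom'.comp ev).comp φ.hom.toAddMonoidHom).flip)
    (fun z t n => by
      change ev (φ.hom n) (z • t) = ev (φ.hom (z • n)) t
      rw [map_zsmul, map_zsmul φ.hom z n, map_zsmul ev z (φ.hom n), LinearMap.smul_apply])

theorem intTensorLift_tmul {X : RMod R} (φ : N ⟶ (homFunctor T).obj X) (t : T) (n : N) :
    intTensorLift φ (t ⊗ₜ n) = ev (φ.hom n) t := rfl

theorem intTensorLift_smul {X : RMod R} (φ : N ⟶ (homFunctor T).obj X) (r : Rᵐᵒᵖ)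
    (z : T ⊗[ℤ] N) : intTensorLift φ (r • z) = r • intTensorLift φ z := by
  induction z using TensorProduct.induction_on with
  | zero => rw [smul_zero, map_zero, smul_zero]
  | tmul t n => rw [TensorProduct.smul_tmul', intTensorLift_tmul, intTensorLift_tmul, map_smul]
  | add x y hx hy => rw [smul_add, map_add, map_add, hx, hy, smul_add]

/-- The linear map underlying `tensorLift`, on the tensor product over `ℤ`. -/
def linearTensorLift {X : RMod R} (φ : N ⟶ (homFunctor T).obj X) : T ⊗[ℤ] N →ₗ[Rᵐᵒᵖ] X where
  toFun := intTensorLift φ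
  map_add' := map_add _
  map_smul' := intTensorLift_smul φ

theorem linearTensorLift_tmul {X : RMod R} (φ : N ⟶ (homFunctor T).obj X) (t : T) (n : N) :
    linearTensorLift φ (t ⊗ₜ n) = ev (φ.hom n) t := rfl

/-- The map `N ⊗_S T ⟶ X` corresponding to a map `N ⟶ Hom(T, X)`. -/
def tensorLift {X : RMod R} (φ : N ⟶ (homFunctor T).obj X) : (tensorFunctor T).obj N ⟶ X :=
  ModuleCat.ofHom <| (tensorRel T N).liftQ (linearTensorLift φ) (by
    refine Submodule.span_le.2 ?_
    rintro _ ⟨s, t, n, rfl⟩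
    rw [SetLike.mem_coe, LinearMap.mem_ker, map_sub, sub_eq_zero, linearTensorLift_tmul,
      linearTensorLift_tmul]
    change ev (φ.hom n) ((s : T ⟶ T).hom t) = ev (φ.hom (n ◃ s)) t
    rw [map_act, ev_act])

@[simp]
theorem tensorLift_tmk {X : RMod R} (φ : N ⟶ (homFunctor T).obj X) (t : T) (n : N) :
    (tensorLift φ).hom (tmk t n) = ev (φ.hom n) t := rfl

/-- The unit `N ⟶ Hom(T, N ⊗_S T)` of the tensor-hom adjunction. -/
def tensorUnit (N : RMod (End T)) : N ⟶ (homFunctor T).obj ((tensorFunctor T).obj N) :=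
  ModuleCat.ofHom
    { toFun := fun n => ofHom (ModuleCat.ofHom
        { toFun := fun t => tmk t n
          map_add' := fun t t' => tmk_add_left t t' n
          map_smul' := fun r t => (smul_tmk r t n).symm })
      map_add' := fun n m => ev_ext fun t => map_add (tmk t) n m
      map_smul' := fun s n => ev_ext fun t => (tmk_apply_left (s.unop : T ⟶ T) t n).symm }

@[simp]
theorem ev_tensorUnit (n : N) (t : T) : ev ((tensorUnit N).hom n) t = tmk t n := rfl

theorem tensor_hom_ext {X : RMod R} {f g : (tensorFunctor T).obj N ⟶ X}
    (h : ∀ (t : T) (n : N), f.hom (tmk t n) = g.hom (tmk t n)) : f = g :=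
  ModuleCat.hom_ext (tensorObj_hom_ext T h)

theorem gen_tensor (N : RMod (End T)) : Gen T ((tensorFunctor T).obj N) := by
  let F : (N →₀ T) →ₗ[Rᵐᵒᵖ] TensorObj T N := Finsupp.lsum ℕ fun n => ev ((tensorUnit N).hom n)
  refine ⟨N, ModuleCat.ofHom F, fun z => ?_⟩
  change ∃ a, F a = z
  obtain ⟨z, rfl⟩ := Submodule.mkQ_surjective _ z
  induction z using TensorProduct.induction_on with
  | zero => exact ⟨0, (map_zero F).trans (map_zero _).symm⟩
  | tmul t n => exact ⟨Finsupp.single n t, (Finsupp.lsum_single ℕ _ n t).trans rfl⟩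
  | add x y hx hy =>
    obtain ⟨x', hx⟩ := hx
    obtain ⟨y', hy⟩ := hy
    exact ⟨x' + y', by rw [map_add F, hx, hy, map_add (tensorRel T N).mkQ]⟩

end

end Tensor

-- Computing `N ⊗_S T` as `N / N γ`

namespace TiltingData

variable {R : Type u} [Ring R] {T : RMod R} {t₀ : T} {e γ : T ⟶ T} (h : TiltingData t₀ e γ)
include h

theorem exists_apply_eq_self (t : T) : ∃ s : T ⟶ T, s.hom t₀ = t :=
  h.exists_apply_eq (gen_self T) t

theorem exists_liftsScalar (r : Rᵐᵒᵖ) : ∃ s c, LiftsScalar t₀ e γ r s c := by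
  obtain ⟨s, hs⟩ := h.exists_apply_eq_self (r • t₀)
  obtain ⟨k, hk⟩ := h.exists_factor (s ≫ γ) (by
    change γ.hom (s.hom t₀) = 0
    rw [hs, map_smul, h.apply_eq_zero, smul_zero])
  refine ⟨s, e ≫ k ≫ e, hs, ?_, ?_, ?_⟩
  · rw [← Category.assoc, h.comp_idem, ← Category.assoc, ← hk, Category.assoc, h.comp_idem]
  · rw [← Category.assoc, h.idem]
  · rw [Category.assoc, Category.assoc, h.idem]

section

variable {N : RMod (End T)}

theorem act_act_idem (n : N) : n ◃ e ◃ e = n ◃ e := by rw [act_act, h.idem]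

theorem act_idem_act (n : N) : n ◃ e ◃ γ = n ◃ γ := by rw [act_act, h.comp_idem]

theorem tmk_act_eq_zero (n : N) : tmk t₀ (n ◃ γ) = 0 := by
  rw [← tmk_apply_left, h.apply_eq_zero]
  change (tensorRel T N).mkQ _ = 0
  rw [TensorProduct.zero_tmul, map_zero]

theorem exists_tmk_eq (z : TensorObj T N) : ∃ n : N, tmk t₀ n = z := by
  obtain ⟨z, rfl⟩ := Submodule.mkQ_surjective _ z
  induction z using TensorProduct.induction_on with
  | zero => exact ⟨0, by rw [map_zero, map_zero]⟩
  | tmul t n =>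
    obtain ⟨s, rfl⟩ := h.exists_apply_eq_self t
    exact ⟨n ◃ s, (tmk_apply_left s t₀ n).symm⟩
  | add x y hx hy =>
    obtain ⟨x', hx⟩ := hx
    obtain ⟨y', hy⟩ := hy
    exact ⟨x' + y', by rw [map_add, map_add, hx, hy]⟩

/-- An inverse to `N / N γ → N ⊗_S T` sends `t ⊗ n` to the class of `n s` for any `s` with `s t₀ =
t`; the choice is harmless because the annihilator of `t₀` is `S γ`. -/
theorem tmk_eq_zero_iff (n : N) : tmk t₀ n = 0 ↔ ∃ m, n = m ◃ γ := by
  refine ⟨fun hn => ?_, fun ⟨m, hm⟩ => hm ▸ h.tmk_act_eq_zero m⟩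
  let I : AddSubgroup N := (DistribSMul.toAddMonoidHom N (op γ : (End T)ᵐᵒᵖ)).range
  have hI : ∀ (n : N) (s s' : T ⟶ T), s.hom t₀ = s'.hom t₀ →
      QuotientAddGroup.mk' I (n ◃ s) = QuotientAddGroup.mk' I (n ◃ s') := by
    intro n s s' hs
    obtain ⟨k, hk⟩ := h.exists_factor (s - s') (by
      rw [ModuleCat.hom_sub, LinearMap.sub_apply, hs, sub_self])
    rw [← sub_eq_zero, ← map_sub, ← act_sub_right, hk, ← act_act]
    exact (QuotientAddGroup.eq_zero_iff _).2 ⟨n ◃ k, rfl⟩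
  choose σ hσ using h.exists_apply_eq_self
  let L : T ⊗[ℤ] N →+ N ⧸ I := TensorProduct.liftAddHom
    { toFun := fun t =>
        { toFun := fun n => QuotientAddGroup.mk' I (n ◃ σ t)
          map_zero' := by rw [act_zero, map_zero]
          map_add' := fun n m => by rw [act_add, map_add] }
      map_zero' := by
        ext n
        refine (hI n (σ 0) 0 (by rw [hσ]; rfl)).trans ?_
        rw [act_zero_right, map_zero]
        rfl
      map_add' := fun t t' => by
        ext n
        refine (hI n (σ (t + t')) (σ t + σ t') ?_).trans ?_
        · rw [hσ, ModuleCat.hom_add, LinearMap.add_apply, hσ, hσ]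
        · rw [act_add_right, map_add]
          rfl }
    (fun z t n => by
      change QuotientAddGroup.mk' I (n ◃ σ (z • t)) = QuotientAddGroup.mk' I ((z • n) ◃ σ t)
      have hz : (z • n) ◃ σ t = n ◃ (z • σ t) := by
        have h₁ : (z • n) ◃ σ t = z • (n ◃ σ t) := smul_comm _ _ _
        have h₂ : n ◃ (z • σ t) = z • (n ◃ σ t) :=
          smul_assoc z (op (σ t : End T) : (End T)ᵐᵒᵖ) n
        rw [h₁, h₂]
      rw [hz]
      refine hI _ _ _ ?_
      rw [hσ, ModuleCat.hom_zsmul, LinearMap.smul_apply, hσ])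
  have hL : ∀ (t : T) (n : N) (s : T ⟶ T), s.hom t₀ = t →
      L (t ⊗ₜ n) = QuotientAddGroup.mk' I (n ◃ s) := fun t n s hs =>
    hI n (σ t) s (by rw [hσ, hs])
  -- `L` is only additive, whereas the relations form an `R`-span; quantifying over `r` makes the
  -- span induction close.
  have hrel : ∀ z ∈ tensorRel T N, ∀ r : Rᵐᵒᵖ, L (r • z) = 0 := by
    intro z hz
    induction hz using Submodule.span_induction with
    | mem z hz =>
      obtain ⟨s, t, n, rfl⟩ := hz
      intro r
      change L (r • (_ - t ⊗ₜ[ℤ] (n ◃ s))) = 0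
      rw [smul_sub, map_sub, TensorProduct.smul_tmul', TensorProduct.smul_tmul',
        hL (r • (s : T ⟶ T).hom t) n (σ (r • t) ≫ s) ?_,
        hL (r • t) (n ◃ s) (σ (r • t)) (hσ _), act_act, sub_self]
      change (s : T ⟶ T).hom ((σ (r • t)).hom t₀) = _
      rw [hσ, map_smul]
    | zero => intro r; rw [smul_zero, map_zero]
    | add x y _ _ hx hy => intro r; rw [smul_add, map_add, hx, hy, add_zero]
    | smul a x _ hx => intro r; rw [smul_smul, hx]
  have hmem : t₀ ⊗ₜ[ℤ] n ∈ tensorRel T N := (Submodule.Quotient.mk_eq_zero _).1 hn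
  have h0 := hrel _ hmem 1
  rw [one_smul, hL t₀ n (𝟙 T) rfl, act_id] at h0
  obtain ⟨m, hm⟩ := (QuotientAddGroup.eq_zero_iff _).1 h0
  exact ⟨m, hm.symm⟩

end

end TiltingData

-- Cogenerators and presentations

section Modules

variable {A : Type u} [Ring A]

theorem eq_zero_of_coseparator {W : RMod A} (hW : IsCoseparator W) {X : RMod A} {x : X}
    (hx : ∀ w : X ⟶ W, w.hom x = 0) : x = 0 := by
  have : fromRegular x = 0 := by
    refine (isCoseparator_def W).1 hW _ _ fun w => ?_
    rw [fromRegular_comp, hx, Limits.zero_comp]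
    exact regular_hom_ext (smul_zero _)
  have := congrArg (fun k : regular A ⟶ X => k.hom (1 : A)) this
  change op (1 : A) • x = 0 at this
  rwa [MulOpposite.op_one, one_smul] at this

variable (N : RMod A)

/-- A short exact sequence ending in `N` with projective middle term. -/
def projectivePresentation : ShortComplex (RMod A) :=
  ShortComplex.mk (kernel.ι (Projective.π N)) (Projective.π N) (kernel.condition _)

theorem projectivePresentation_shortExact : (projectivePresentation N).ShortExact where
  exact := ShortComplex.exact_kernel _
  mono_f := inferInstanceAs (Mono (kernel.ι (Projective.π N)))
  epi_g := inferInstanceAs (Epi (Projective.π N))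

instance projective_projectivePresentation : Projective (projectivePresentation N).X₂ :=
  inferInstanceAs (Projective (Projective.over N))

/-- A short exact sequence starting in `N` with injective middle term. -/
def injectivePresentation : ShortComplex (RMod A) :=
  ShortComplex.mk (Injective.ι N) (cokernel.π (Injective.ι N)) (cokernel.condition _)

theorem injectivePresentation_shortExact : (injectivePresentation N).ShortExact where
  exact := ShortComplex.exact_cokernel _
  mono_f := inferInstanceAs (Mono (Injective.ι N))
  epi_g := inferInstanceAs (Epi (cokernel.π (Injective.ι N)))

instance injective_injectivePresentation : Injective (injectivePresentation N).X₂ :=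
  inferInstanceAs (Injective (Injective.under N))

variable {N} {S : ShortComplex (RMod A)}

theorem g_f_apply (k : S.X₁) : S.g.hom (S.f.hom k) = 0 :=
  congrArg (fun φ : S.X₁ ⟶ S.X₃ => φ.hom k) S.zero

theorem shortExact_exists_eq (hS : S.ShortExact) {x : S.X₂} (hx : S.g.hom x = 0) :
    ∃ k, S.f.hom k = x :=
  (S.moduleCat_exact_iff).1 hS.exact x hx

end Modules

-- The class `ℰ` through `Tor₁` and the tensor product

section Perp

variable {R : Type u} [Ring R] {T : RMod R}

/-- `Tor₁(N, T) = 0`, computed from the presentation of `T` given by `t₀`, `e`, `γ`. -/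
def TorZero (e γ : T ⟶ T) (N : RMod (End T)) : Prop :=
  ∀ n : N, n ◃ e = n → n ◃ γ = 0 → n = 0

/-- `N ⊗_S T = 0`, computed from the presentation of `T` given by `t₀`, `e`, `γ`. -/
def TensorZero (γ : T ⟶ T) (N : RMod (End T)) : Prop :=
  ∀ n : N, ∃ m, n = m ◃ γ

theorem TorZero.of_injective {e γ : T ⟶ T} {N N' : RMod (End T)} (hN' : TorZero e γ N')
    (f : N ⟶ N') (hf : Function.Injective f.hom) : TorZero e γ N := fun n hn hn' =>
  hf <| (hN' _ (by rw [← map_act, hn]) (by rw [← map_act, hn', map_zero])).trans (map_zero _).symm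

theorem TensorZero.of_surjective {γ : T ⟶ T} {N N' : RMod (End T)} (hN : TensorZero γ N)
    (f : N ⟶ N') (hf : Function.Surjective f.hom) : TensorZero γ N' := fun n => by
  obtain ⟨n, rfl⟩ := hf n
  obtain ⟨m, rfl⟩ := hN n
  exact ⟨f.hom m, map_act _ _ _⟩

namespace TiltingData

variable {t₀ : T} {e γ : T ⟶ T} (h : TiltingData t₀ e γ)
include h

theorem torZero_hom (X : RMod R) : TorZero e γ ((homFunctor T).obj X) := by
  intro f hf hf'
  rw [← hf]
  exact h.comp_eq_zero f hf'

/-- A projective embeds in a free module, and for `S` itself the claim is the injectivity of `S e →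
S γ`. -/
theorem torZero_of_projective (P : RMod (End T)) [Projective P] : TorZero e γ P := by
  let Q : RMod (End T) := ModuleCat.of _ (P →₀ (End T)ᵐᵒᵖ)
  let π : Q ⟶ P := ModuleCat.ofHom (Finsupp.linearCombination _ id)
  have hπ : Epi π := (ModuleCat.epi_iff_surjective π).2
    (Finsupp.linearCombination_id_surjective _ _)
  let σ : P ⟶ Q := Projective.factorThru (𝟙 P) π
  have hσ : Mono σ := mono_of_mono_fac (Projective.factorThru_comp (𝟙 P) π)
  refine TorZero.of_injective (fun n hn hn' => ?_) σ ((ModuleCat.mono_iff_injective σ).1 hσ)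
  refine Finsupp.ext fun p => ?_
  have h₁ : (op e : (End T)ᵐᵒᵖ) * n p = n p := DFunLike.congr_fun hn p
  have h₂ : (op γ : (End T)ᵐᵒᵖ) * n p = 0 := DFunLike.congr_fun hn' p
  refine h₁.symm.trans (MulOpposite.unop_injective ?_)
  exact h.comp_eq_zero (n p).unop (congrArg MulOpposite.unop h₂)

section

variable {N : RMod (End T)}

theorem hom_eq_zero (hN : TensorZero γ N) {X : RMod R} (φ : N ⟶ (homFunctor T).obj X) : φ = 0 := by
  refine ModuleCat.hom_ext (LinearMap.ext fun n => ev_ext fun t => ?_)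
  obtain ⟨s, rfl⟩ := h.exists_apply_eq_self t
  obtain ⟨m, hm⟩ := hN (n ◃ s)
  rw [← ev_act, ← map_act, hm, map_act, ev_act, h.apply_eq_zero, map_zero]
  rfl

theorem tensorZero_iff : TensorZero γ N ↔ ∀ n : N, tmk t₀ n = 0 :=
  forall_congr' fun n => (h.tmk_eq_zero_iff n).symm

variable {S : ShortComplex (RMod (End T))} (hS : S.ShortExact)
include hS

theorem surjective_tensor_map (h₃ : TensorZero γ S.X₃) :
    Function.Surjective ((tensorFunctor T).map S.f).hom := by
  intro z
  obtain ⟨n, rfl⟩ := h.exists_tmk_eq z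
  obtain ⟨m, hm⟩ := h₃ (S.g.hom n)
  obtain ⟨m, rfl⟩ := hS.moduleCat_surjective_g m
  obtain ⟨k, hk⟩ := shortExact_exists_eq hS (x := n - m ◃ γ) (by
    rw [map_sub, map_act, sub_eq_zero]; exact hm)
  refine ⟨tmk t₀ k, ?_⟩
  rw [tensorFunctor_map_tmk, hk, map_sub, h.tmk_act_eq_zero, sub_zero]

/-- The kernel comes from `Tor₁(X₃, T)`: if `f k = p γ`, then `g (p e)` represents a class there. -/
theorem injective_tensor_map (h₃ : TorZero e γ S.X₃) :
    Function.Injective ((tensorFunctor T).map S.f).hom := by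
  rw [injective_iff_map_eq_zero]
  intro z hz
  obtain ⟨k, rfl⟩ := h.exists_tmk_eq z
  rw [tensorFunctor_map_tmk] at hz
  obtain ⟨p, hp⟩ := (h.tmk_eq_zero_iff _).1 hz
  have hgp : S.g.hom (p ◃ e) = 0 := by
    refine h₃ _ ?_ ?_
    · rw [← map_act, h.act_act_idem]
    · rw [← map_act, h.act_idem_act, ← hp, g_f_apply]
  obtain ⟨k', hk'⟩ := shortExact_exists_eq hS hgp
  have : k = k' ◃ γ := hS.moduleCat_injective_f (by
    change S.f.hom k = S.f.hom (k' ◃ γ)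
    rw [hp, map_act, hk', h.act_idem_act])
  rw [this, h.tmk_act_eq_zero]
  rfl

omit h in
-- By adjunction, extending `X₁ → Hom(T, X)` to `X₂` amounts to extending `X₁ ⊗ T → X` to `X₂ ⊗ T`.
theorem ext_hom_subsingleton_of_extension [Projective S.X₂] {X : RMod R}
    (hext : ∀ f : (tensorFunctor T).obj S.X₁ ⟶ X, ∃ f', (tensorFunctor T).map S.f ≫ f' = f) :
    Subsingleton (Ext S.X₃ ((homFunctor T).obj X) 1) := by
  refine ext_one_subsingleton_of_extension hS
    (subsingleton_of_forall_eq 0 Ext.eq_zero_of_projective) fun f => ?_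
  obtain ⟨f', hf'⟩ := hext (tensorLift f)
  refine ⟨tensorUnit S.X₂ ≫ (homFunctor T).map f', ?_⟩
  refine ModuleCat.hom_ext (LinearMap.ext fun k => ev_ext fun t => ?_)
  have := congrArg (fun φ : (tensorFunctor T).obj S.X₁ ⟶ X => φ.hom (tmk t k)) hf'
  exact this

end

variable {N : RMod (End T)}

theorem ext_hom_subsingleton (hN : TorZero e γ N) (hN' : TensorZero γ N) (X : RMod R) :
    Subsingleton (Ext N ((homFunctor T).obj X) 1) := by
  have hS := projectivePresentation_shortExact N
  have : IsIso ((tensorFunctor T).map (projectivePresentation N).f) :=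
    (ConcreteCategory.isIso_iff_bijective _).2
      ⟨h.injective_tensor_map hS hN, h.surjective_tensor_map hS hN'⟩
  exact ext_hom_subsingleton_of_extension hS fun f =>
    ⟨inv ((tensorFunctor T).map (projectivePresentation N).f) ≫ f, IsIso.hom_inv_id_assoc _ _⟩

theorem ext_hom_subsingleton_of_injective (hN : TorZero e γ N) (I : RMod R) [Injective I] :
    Subsingleton (Ext N ((homFunctor T).obj I) 1) := by
  have hS := projectivePresentation_shortExact N
  have : Mono ((tensorFunctor T).map (projectivePresentation N).f) :=
    (ModuleCat.mono_iff_injective _).2 (h.injective_tensor_map hS hN)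
  exact ext_hom_subsingleton_of_extension hS fun f =>
    ⟨Injective.factorThru f _, Injective.comp_factorThru _ _⟩

/-- Dimension shifting: the syzygy embeds in a projective, so its `Tor₁` vanishes. -/
theorem ext_two_hom_subsingleton_of_injective (N : RMod (End T)) (I : RMod R) [Injective I] :
    Subsingleton (Ext N ((homFunctor T).obj I) 2) := by
  have hS := projectivePresentation_shortExact N
  have hK := h.ext_hom_subsingleton_of_injective
    ((h.torZero_of_projective (projectivePresentation N).X₂).of_injective _ hS.moduleCat_injective_f) I
  refine subsingleton_of_forall_eq 0 fun x => ?_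
  obtain ⟨y, rfl⟩ := Ext.contravariant_sequence_exact₃ hS ((homFunctor T).obj I) x
    (Ext.eq_zero_of_projective _) (n₀ := 1) rfl
  rw [Subsingleton.elim y 0, Ext.comp_zero]
  rfl

/-- Write a class in `Tor₁(X₃, T)` as `g p` with `p γ = f k`. Any `X₁ ⊗ T → W` gives a map `X₁ →
T^d` that extends to `X₂`, where `p γ` evaluates to `0` at `t₀`. Hence `t₀ ⊗ k = 0`, so `k = k' γ`,
and `p e - f (k' e)` lies in `Tor₁(X₂, T) = 0`. -/
theorem torZero_of_ext_subsingleton {W : RMod R} (hW : IsCoseparator W)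
    {S : ShortComplex (RMod (End T))} (hS : S.ShortExact) [Projective S.X₂]
    (hE : Subsingleton (Ext S.X₃ (dual T W) 1)) : TorZero e γ S.X₃ := by
  intro n hne hnγ
  obtain ⟨p, rfl⟩ := hS.moduleCat_surjective_g n
  obtain ⟨k, hk⟩ := shortExact_exists_eq hS (x := p ◃ γ) (by rw [map_act]; exact hnγ)
  have hk0 : tmk t₀ k = 0 := by
    refine eq_zero_of_coseparator hW (X := (tensorFunctor T).obj S.X₁) fun w => ?_
    obtain ⟨f', hf'⟩ := exists_extension_of_ext hS hE
      (tensorUnit _ ≫ (homFunctor T).map w)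
    have hw : ev (f'.hom (S.f.hom k)) t₀ = w.hom (tmk t₀ k) :=
      congrArg (fun φ : S.X₁ ⟶ dual T W => ev (φ.hom k) t₀) hf'
    rw [← hw, hk, map_act, ev_act, h.apply_eq_zero, map_zero]
  obtain ⟨k', hk'⟩ := (h.tmk_eq_zero_iff k).1 hk0
  have hp0 : p ◃ e - S.f.hom (k' ◃ e) = 0 := by
    refine h.torZero_of_projective _ _ ?_ ?_
    · rw [act_sub, h.act_act_idem, ← map_act, h.act_act_idem]
    · rw [act_sub, h.act_idem_act, ← map_act, h.act_idem_act, ← hk', hk, sub_self]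
  refine hne.symm.trans ((map_act p e S.g).symm.trans ?_)
  rw [sub_eq_zero.1 hp0, g_f_apply]

theorem tensorZero_of_kerHomTo {W : RMod R} (hW : IsCoseparator W) (hN : KerHomTo (dual T W) N) :
    TensorZero γ N := by
  rw [h.tensorZero_iff]
  intro n
  refine eq_zero_of_coseparator hW (X := (tensorFunctor T).obj N) fun w => ?_
  exact congrArg (fun φ : N ⟶ dual T W => ev (φ.hom n) t₀)
    (hN (tensorUnit N ≫ (homFunctor T).map w))

/-- This frees `ℰ` from `W`: orthogonality to the single module `T^d` becomes orthogonality to all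
`Hom(T, X)`. -/
theorem classE_iff {W : RMod R} (hW : IsCoseparator W) :
    classE T W N ↔ TorZero e γ N ∧ TensorZero γ N := by
  constructor
  · intro hE
    obtain ⟨h₁, h₂⟩ := hE (dual T W) (by simp)
    exact ⟨h.torZero_of_ext_subsingleton hW (projectivePresentation_shortExact N) h₂,
      h.tensorZero_of_kerHomTo hW h₁⟩
  · rintro ⟨h₁, h₂⟩ M hM
    obtain rfl : dual T W = M := by simpa using hM
    exact ⟨h.hom_eq_zero h₂, h.ext_hom_subsingleton h₁ h₂ W⟩

theorem classM_hom {W : RMod R} (hW : IsCoseparator W) (X : RMod R) :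
    classM T W ((homFunctor T).obj X) := fun N hN => by
  obtain ⟨h₁, h₂⟩ := (h.classE_iff hW).1 hN
  exact ⟨h.hom_eq_zero h₂, h.ext_hom_subsingleton h₁ h₂ X⟩

end TiltingData

end Perp

-- The long exact sequence of `Hom(T, -)` and `Ext¹(T, -)`

section Connecting

variable {R : Type u} [Ring R] (T : RMod R) {S : ShortComplex (RMod R)} (hS : S.ShortExact)

/-- The connecting map `Hom(T, X₃) ⟶ Ext¹(T, X₁)` of a short exact sequence. -/
def homConnecting : (homFunctor T).obj S.X₃ ⟶ (ext1Functor T).obj S.X₁ :=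
  ModuleCat.ofHom
    { toFun := fun f => ofExt ((Ext.mk₀ (ofHom.symm f)).comp hS.extClass (zero_add 1))
      map_add' := fun f g => congrArg ofExt (by
        change (Ext.mk₀ (ofHom.symm f + ofHom.symm g)).comp hS.extClass (zero_add 1) = _
        rw [Ext.mk₀_add, Ext.add_comp]
        rfl)
      map_smul' := fun s f => congrArg ofExt
        (Ext.mk₀_comp_mk₀_assoc (s.unop : T ⟶ T) (ofHom.symm f) hS.extClass).symm }

variable {T}

theorem homConnecting_ofHom (f : T ⟶ S.X₃) :
    (homConnecting T hS).hom (ofHom f) = ofExt ((Ext.mk₀ f).comp hS.extClass (zero_add 1)) := rfl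

theorem homConnecting_map_g (f : (homFunctor T).obj S.X₂) :
    (homConnecting T hS).hom (((homFunctor T).map S.g).hom f) = 0 := by
  obtain ⟨f, rfl⟩ := ofHom.surjective f
  rw [homFunctor_map_ofHom, homConnecting_ofHom, ← Ext.mk₀_comp_mk₀_assoc, hS.comp_extClass,
    Ext.comp_zero, map_zero]

theorem exists_eq_of_homConnecting_eq_zero {f : (homFunctor T).obj S.X₃}
    (hf : (homConnecting T hS).hom f = 0) : ∃ f', ((homFunctor T).map S.g).hom f' = f := by
  obtain ⟨f, rfl⟩ := ofHom.surjective f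
  rw [homConnecting_ofHom, EmbeddingLike.map_eq_zero_iff] at hf
  obtain ⟨y, hy⟩ := Ext.covariant_sequence_exact₃ T hS (Ext.mk₀ f) (zero_add 1) hf
  obtain ⟨f', rfl⟩ := (Ext.mk₀_bijective T S.X₂).2 y
  refine ⟨ofHom f', ?_⟩
  rw [homFunctor_map_ofHom]
  exact congrArg ofHom ((Ext.mk₀_bijective _ _).1 (by rw [← hy, Ext.mk₀_comp_mk₀]))

theorem homConnecting_surjective (h₂ : Subsingleton (Ext T S.X₂ 1)) :
    Function.Surjective (homConnecting T hS).hom := by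
  intro x
  obtain ⟨x, rfl⟩ := ofExt.surjective x
  obtain ⟨y, rfl⟩ := Ext.covariant_sequence_exact₁ T hS x (Subsingleton.elim _ _) (zero_add 1)
  obtain ⟨f, rfl⟩ := (Ext.mk₀_bijective T S.X₃).2 y
  exact ⟨ofHom f, homConnecting_ofHom hS f⟩

include hS

theorem homFunctor_map_f_injective : Function.Injective ((homFunctor T).map S.f).hom := by
  have := hS.mono_f
  intro f f' hff'
  obtain ⟨f, rfl⟩ := ofHom.surjective f
  obtain ⟨f', rfl⟩ := ofHom.surjective f'
  rw [homFunctor_map_ofHom, homFunctor_map_ofHom, EmbeddingLike.apply_eq_iff_eq,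
    cancel_mono] at hff'
  rw [hff']

theorem exists_eq_of_homFunctor_map_g_eq_zero {f : (homFunctor T).obj S.X₂}
    (hf : ((homFunctor T).map S.g).hom f = 0) : ∃ f', ((homFunctor T).map S.f).hom f' = f := by
  have := hS.mono_f
  obtain ⟨f, rfl⟩ := ofHom.surjective f
  rw [homFunctor_map_ofHom, EmbeddingLike.map_eq_zero_iff] at hf
  refine ⟨ofHom (hS.exact.lift f hf), ?_⟩
  rw [homFunctor_map_ofHom, hS.exact.lift_f]

theorem homFunctor_map_g_injective (h₁ : KerHomFrom T S.X₁) :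
    Function.Injective ((homFunctor T).map S.g).hom := by
  rw [injective_iff_map_eq_zero]
  intro f hf
  obtain ⟨f', rfl⟩ := exists_eq_of_homFunctor_map_g_eq_zero hS hf
  obtain ⟨f', rfl⟩ := ofHom.surjective f'
  rw [h₁ f', map_zero, map_zero]

/-- If `Hom(T, X₁) = 0 = Ext¹(T, X₂)`, then
`0 ⟶ Hom(T, X₂) ⟶ Hom(T, X₃) ⟶ Ext¹(T, X₁) ⟶ 0` is exact. -/
theorem homConnecting_shortExact (h₁ : KerHomFrom T S.X₁) (h₂ : Subsingleton (Ext T S.X₂ 1)) :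
    (ShortComplex.mk ((homFunctor T).map S.g) (homConnecting T hS)
      (ModuleCat.hom_ext (LinearMap.ext fun f => homConnecting_map_g hS f))).ShortExact where
  exact := (ShortComplex.moduleCat_exact_iff _).2 fun _ hf =>
    exists_eq_of_homConnecting_eq_zero hS hf
  mono_f := (ModuleCat.mono_iff_injective _).2 (homFunctor_map_g_injective hS h₁)
  epi_g := (ModuleCat.epi_iff_surjective _).2 (homConnecting_surjective hS h₂)

end Connecting

-- Criteria for inverse equivalences

section InverseEquivalences

variable {C D : Type*} [Category* C] [Category* D] {P : ObjectProperty C} {Q : ObjectProperty D}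
  {F : C ⥤ D} {G : D ⥤ C}

theorem inverseEquivalences_of_iso (hF : ∀ X, P X → Q (F.obj X)) (hG : ∀ Y, Q Y → P (G.obj Y))
    (η : ∀ X, P X → (X ≅ G.obj (F.obj X))) (ε : ∀ Y, Q Y → (F.obj (G.obj Y) ≅ Y))
    (hη : ∀ {X X'} (hX : P X) (hX' : P X') (f : X ⟶ X'),
      f ≫ (η X' hX').hom = (η X hX).hom ≫ G.map (F.map f))
    (hε : ∀ {Y Y'} (hY : Q Y) (hY' : Q Y') (f : Y ⟶ Y'),
      F.map (G.map f) ≫ (ε Y' hY').hom = (ε Y hY).hom ≫ f) :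
    InverseEquivalences P Q F G :=
  ⟨hF, hG, CategoryTheory.Equivalence.mk
    (Q.lift (P.ι ⋙ F) (fun X => hF X.obj X.property))
    (P.lift (Q.ι ⋙ G) (fun Y => hG Y.obj Y.property))
    (NatIso.ofComponents (fun X => P.isoMk (η X.obj X.property))
      fun {X X'} f => P.hom_ext (hη X.property X'.property f.hom))
    (NatIso.ofComponents (fun Y => Q.isoMk (ε Y.obj Y.property))
      fun {Y Y'} f => Q.hom_ext (hε Y.property Y'.property f.hom)), rfl, rfl⟩

/-- This avoids a natural counit: `η` with `G` faithful makes `F` fully faithful, and isomorphisms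
chosen object by object give essential surjectivity. -/
theorem inverseEquivalences_of_faithful
    (hF : ∀ X, P X → Q (F.obj X)) (hG : ∀ Y, Q Y → P (G.obj Y))
    (η : ∀ X, P X → (X ≅ G.obj (F.obj X)))
    (hη : ∀ {X X'} (hX : P X) (hX' : P X') (f : X ⟶ X'),
      f ≫ (η X' hX').hom = (η X hX).hom ≫ G.map (F.map f))
    (hsurj : ∀ Y, Q Y → ∃ X, P X ∧ Nonempty (F.obj X ≅ Y))
    (hfaith : ∀ {Y Y'} (_ : Q Y) (_ : Q Y') (f g : Y ⟶ Y'), G.map f = G.map g → f = g) :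
    InverseEquivalences P Q F G := by
  let F' := Q.lift (P.ι ⋙ F) (fun X => hF X.obj X.property)
  let G' := P.lift (Q.ι ⋙ G) (fun Y => hG Y.obj Y.property)
  let η' : 𝟭 P.FullSubcategory ≅ F' ⋙ G' :=
    NatIso.ofComponents (fun X => P.isoMk (η X.obj X.property))
      fun {X X'} f => P.hom_ext (hη X.property X'.property f.hom)
  have : G'.Faithful := ⟨fun {Y Y'} f g hfg => Q.hom_ext
    (hfaith Y.property Y'.property f.hom g.hom (P.ι.congr_map hfg))⟩
  have : F'.Faithful := Functor.Faithful.of_comp_iso (H := 𝟭 _) η'.symm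
  have : F'.Full := ⟨fun {X X'} k => ⟨η'.hom.app X ≫ G'.map k ≫ η'.inv.app X', by
    refine G'.map_injective ?_
    have := η'.inv.naturality (η'.hom.app X ≫ G'.map k ≫ η'.inv.app X')
    rw [← cancel_mono (η'.inv.app X')]
    refine this.trans ?_
    simp⟩⟩
  have : F'.EssSurj := ⟨fun Y => by
    obtain ⟨X, hX, ⟨i⟩⟩ := hsurj Y.obj Y.property
    exact ⟨⟨X, hX⟩, ⟨Q.isoMk i⟩⟩⟩
  have : F'.IsEquivalence := {}
  -- Precompose with `F'.inv ⋙ F'` and cancel `F' ⋙ G'`, so that the inverse is `G'` itself.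
  let ε' : G' ⋙ F' ≅ 𝟭 Q.FullSubcategory :=
    (Functor.isoWhiskerRight F'.asEquivalence.counitIso (G' ⋙ F')).symm ≪≫
      Functor.isoWhiskerLeft F'.inv (Functor.isoWhiskerRight η'.symm F') ≪≫
      F'.asEquivalence.counitIso
  exact ⟨hF, hG, CategoryTheory.Equivalence.mk F' G' η' ε', rfl, rfl⟩

end InverseEquivalences

-- The class `ℳ` and the first equivalence

namespace TiltingData

variable {R : Type u} [Ring R] {T : RMod R} {t₀ : T} {e γ : T ⟶ T} (h : TiltingData t₀ e γ)
include h

/-- For `X → I` an injective embedding, `0 → Hom(T, I) → Hom(T, I/X) → Ext¹(T, X) → 0` is exact. For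
`N ∈ ℰ`, `Hom` and `Ext¹` into the first two terms vanish, as does `Ext²(N, Hom(T, I))`. -/
theorem classM_ext {W : RMod R} (hW : IsCoseparator W) {X : RMod R} (hX : KerHomFrom T X) :
    classM T W ((ext1Functor T).obj X) := fun N hN => by
  obtain ⟨h₁, h₂⟩ := (h.classE_iff hW).1 hN
  have hI := injectivePresentation_shortExact X
  have hS := homConnecting_shortExact hI hX
    (subsingleton_of_forall_eq 0 (Ext.eq_zero_of_injective (I := (injectivePresentation X).X₂)))
  constructor
  · intro φ
    obtain ⟨φ', rfl⟩ := exists_lift_of_ext hS (h.ext_hom_subsingleton h₁ h₂ _) φ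
    rw [h.hom_eq_zero h₂ φ']
    exact Limits.zero_comp
  · refine subsingleton_of_forall_eq 0 fun x => ?_
    have := h.ext_two_hom_subsingleton_of_injective N (injectivePresentation X).X₂
    obtain ⟨y, rfl⟩ := Ext.covariant_sequence_exact₃ N hS x (n₁ := 2) rfl
      (Subsingleton.elim _ _)
    have := h.ext_hom_subsingleton h₁ h₂ (injectivePresentation X).X₃
    obtain rfl : y = 0 := Subsingleton.elim _ _
    exact Ext.zero_comp (C := RMod (End T)) _ _ _ _ _

/-- If the cokernel of an injective map `f : N ⟶ H` belongs to `ℰ`, with `N` in `ℳ` and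
`Hom(ℰ, H) = 0`, then `f` is an isomorphism. -/
theorem surjective_of_cokernel_classE {W : RMod R} (hW : IsCoseparator W)
    {N H : RMod (End T)} (f : N ⟶ H) (hf : Function.Injective f.hom)
    (hN : classM T W N) (hH : ∀ (C : RMod (End T)) (φ : C ⟶ H), classE T W C → φ = 0)
    (h₁ : ∀ x : H, x ◃ e = x → (∃ n, x ◃ γ = f.hom n) → ∃ n, x = f.hom n)
    (h₂ : ∀ x : H, ∃ n y, x = f.hom n + y ◃ γ) : Function.Surjective f.hom := by
  let S : ShortComplex (RMod (End T)) := ShortComplex.mk f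
    (ModuleCat.ofHom (LinearMap.range f.hom).mkQ) (ModuleCat.hom_ext (LinearMap.ext fun n =>
      (Submodule.Quotient.mk_eq_zero _).2 ⟨n, rfl⟩))
  have hS : S.ShortExact :=
    { exact := (ShortComplex.moduleCat_exact_iff _).2 fun x hx =>
        (Submodule.Quotient.mk_eq_zero (LinearMap.range f.hom)).1 hx
      mono_f := (ModuleCat.mono_iff_injective _).2 hf
      epi_g := (ModuleCat.epi_iff_surjective _).2 (Submodule.mkQ_surjective _) }
  -- `h₁` yields `Tor₁ = 0` for the cokernel, and `h₂` that its tensor product with `T` vanishes.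
  have hC : classE T W S.X₃ := by
    refine (h.classE_iff hW).2 ⟨fun x hx hx' => ?_, fun x => ?_⟩
    · obtain ⟨x, rfl⟩ := hS.moduleCat_surjective_g x
      obtain ⟨n, hn⟩ := h₁ (x ◃ e) (h.act_act_idem x) (by
        rw [h.act_idem_act]
        obtain ⟨n, hn⟩ := shortExact_exists_eq hS (x := x ◃ γ) (by rw [map_act]; exact hx')
        exact ⟨n, hn.symm⟩)
      refine hx.symm.trans ((map_act x e S.g).symm.trans ?_)
      rw [hn]
      exact g_f_apply (S := S) n
    · obtain ⟨x, rfl⟩ := hS.moduleCat_surjective_g x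
      obtain ⟨n, y, rfl⟩ := h₂ x
      refine ⟨S.g.hom y, (map_add S.g.hom _ _).trans ?_⟩
      rw [map_act, g_f_apply (S := S) n, zero_add]
  -- `Ext¹(C, N) = 0` splits the sequence, but the section `C → H` is zero, so `C = 0`.
  obtain ⟨σ, hσ⟩ := exists_lift_of_ext hS (hN _ hC).2 (𝟙 S.X₃)
  rw [hH _ σ hC, Limits.zero_comp] at hσ
  intro x
  refine shortExact_exists_eq hS (x := x) ?_
  exact congrArg (fun φ : S.X₃ ⟶ S.X₃ => φ.hom (S.g.hom x)) hσ.symm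

section Unit

theorem tmk_eq_iff {N : RMod (End T)} (n n' : N) : tmk t₀ n = tmk t₀ n' ↔ ∃ m, n = n' + m ◃ γ := by
  rw [← sub_eq_zero, ← map_sub, h.tmk_eq_zero_iff]
  exact exists_congr fun m => sub_eq_iff_eq_add'

theorem ev_eq_zero_iff {X : RMod R} (f : (homFunctor T).obj X) :
    ev f t₀ = 0 ↔ ∃ k, f = k ◃ γ := by
  refine ⟨fun hf => h.exists_factor (ofHom.symm f) hf, ?_⟩
  rintro ⟨k, rfl⟩
  rw [ev_act, h.apply_eq_zero, map_zero]

theorem exists_tensorUnit_add {N : RMod (End T)}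
    (x : (homFunctor T).obj ((tensorFunctor T).obj N)) :
    ∃ n y, x = (tensorUnit N).hom n + y ◃ γ := by
  obtain ⟨n, hn⟩ := h.exists_tmk_eq (ev x t₀)
  obtain ⟨y, hy⟩ := (h.ev_eq_zero_iff (x - (tensorUnit N).hom n)).1 (by
    rw [map_sub, LinearMap.sub_apply, ev_tensorUnit, hn, sub_self])
  exact ⟨n, y, by rw [← hy, add_sub_cancel]⟩

theorem exists_of_tensorUnit_eq_act {N : RMod (End T)} {n : N}
    {x : (homFunctor T).obj ((tensorFunctor T).obj N)} (hx : (tensorUnit N).hom n = x ◃ γ) :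
    ∃ m, n = m ◃ γ := by
  rw [← h.tmk_eq_zero_iff, ← ev_tensorUnit, hx, ev_act, h.apply_eq_zero, map_zero]
  rfl

theorem hom_eq_of_act_eq {X : RMod R} {x y : (homFunctor T).obj X} (hxy : x ◃ γ = y ◃ γ) :
    x ◃ e = y ◃ e := by
  rw [← sub_eq_zero, ← act_sub]
  exact h.torZero_hom X _ (h.act_act_idem _) (by rw [h.act_idem_act, act_sub, hxy, sub_self])

end Unit

omit h in
-- Every map `N → T^d` factors through the unit, and such maps separate the elements of `N`.
theorem _root_.BrennerButler.tensorUnit_injective_of_cogen {W : RMod R} {N : RMod (End T)}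
    (hN : Cogen (dual T W) N) : Function.Injective (tensorUnit N).hom := by
  obtain ⟨ι, f, hf⟩ := hN
  rw [injective_iff_map_eq_zero]
  intro n hn
  refine hf (Eq.trans (funext fun i => ?_) (map_zero f.hom).symm)
  let φ : N ⟶ dual T W := f ≫ ModuleCat.ofHom (LinearMap.proj i)
  change φ.hom n = 0
  have : φ = tensorUnit N ≫ (homFunctor T).map (tensorLift φ) := rfl
  rw [this]
  change ((homFunctor T).map (tensorLift φ)).hom ((tensorUnit N).hom n) = 0
  rw [hn, map_zero]

theorem bijective_tensorUnit {W : RMod R} (hW : IsCoseparator W) {N : RMod (End T)}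
    (hN : classY T W N) : Function.Bijective (tensorUnit N).hom := by
  have hinj := tensorUnit_injective_of_cogen hN.1
  refine ⟨hinj, h.surjective_of_cokernel_classE hW _ hinj hN.2
    (fun C φ hC => ((h.classM_hom hW _ C hC).1 φ)) ?_ h.exists_tensorUnit_add⟩
  rintro x hx ⟨n, hn⟩
  obtain ⟨m, rfl⟩ := h.exists_of_tensorUnit_eq_act hn.symm
  refine ⟨m ◃ e, ?_⟩
  rw [map_act] at hn
  rw [← hx, h.hom_eq_of_act_eq hn, map_act]

theorem bijective_tensorCounit {X : RMod R} (hX : Gen T X) :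
    Function.Bijective (tensorLift (𝟙 ((homFunctor T).obj X))).hom := by
  constructor
  · rw [injective_iff_map_eq_zero]
    intro z hz
    obtain ⟨f, rfl⟩ := h.exists_tmk_eq z
    rw [tensorLift_tmk] at hz
    exact (h.tmk_eq_zero_iff f).2 ((h.ev_eq_zero_iff f).1 hz)
  · intro x
    obtain ⟨f, rfl⟩ := h.exists_apply_eq hX x
    exact ⟨tmk t₀ (ofHom f), rfl⟩

omit h in
theorem _root_.BrennerButler.cogen_hom {W : RMod R} (hW : IsCoseparator W) (X : RMod R) :
    Cogen (dual T W) ((homFunctor T).obj X) := by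
  refine ⟨X ⟶ W, ModuleCat.ofHom (LinearMap.pi fun w => ((homFunctor T).map w).hom), ?_⟩
  refine (injective_iff_map_eq_zero _).2 fun f hf => ev_ext fun t => ?_
  refine eq_zero_of_coseparator hW fun w => ?_
  rw [← ev_map]
  have : ((homFunctor T).map w).hom f = 0 := congrFun hf w
  rw [this]
  rfl

theorem inverseEquivalences_hom_tensor {W : RMod R} (hW : IsCoseparator W) :
    InverseEquivalences (Gen T) (classY T W) (homFunctor T) (tensorFunctor T) := by
  have hη (X : RMod R) (hX : Gen T X) : IsIso (tensorLift (𝟙 ((homFunctor T).obj X))) :=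
    (ConcreteCategory.isIso_iff_bijective _).2 (h.bijective_tensorCounit hX)
  have hε (N : RMod (End T)) (hN : classY T W N) : IsIso (tensorUnit N) :=
    (ConcreteCategory.isIso_iff_bijective _).2 (h.bijective_tensorUnit hW hN)
  refine inverseEquivalences_of_iso (fun X _ => ⟨cogen_hom hW X, h.classM_hom hW X⟩)
    (fun N _ => gen_tensor N) (fun X hX => (@asIso _ _ _ _ _ (hη X hX)).symm)
    (fun N hN => (@asIso _ _ _ _ _ (hε N hN)).symm) (fun {X X'} hX hX' f => ?_)
    (fun {N N'} hN hN' f => ?_)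
  · rw [Iso.symm_hom, Iso.symm_hom, Iso.comp_inv_eq, Category.assoc, Iso.eq_inv_comp]
    exact tensor_hom_ext fun t g => rfl
  · rw [Iso.symm_hom, Iso.symm_hom, Iso.comp_inv_eq, Category.assoc, Iso.eq_inv_comp]
    exact ModuleCat.hom_ext (LinearMap.ext fun n => ev_ext fun t => rfl)

end TiltingData

-- `Tor₁` from resolutions, and its uniqueness

namespace TiltingData

variable {R : Type u} [Ring R] {T : RMod R} {t₀ : T} {e γ : T ⟶ T} (h : TiltingData t₀ e γ)
include h

/-- The homology at `P₁ ⊗_S T` of `P₂ ⊗_S T ⟶ P₁ ⊗_S T ⟶ P₀ ⊗_S T`, for an exact sequence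
`P₂ ⟶ P₁ ⟶ P₀ ⟶ N ⟶ 0` with `Tor₁(P₀, T) = 0`, computes `Tor₁(N, T)`. -/
theorem exists_isTor_of_exact {P₂ P₁ P₀ N : RMod (End T)} {d₂ : P₂ ⟶ P₁} {d₁ : P₁ ⟶ P₀}
    {ε : P₀ ⟶ N} (h₀ : TorZero e γ P₀) (hd₁ : ∀ a, d₁.hom a = 0 → ∃ b, d₂.hom b = a)
    (hd₂ : ∀ b, d₁.hom (d₂.hom b) = 0) (hε₁ : ∀ p, ε.hom p = 0 → ∃ a, d₁.hom a = p)
    (hε₂ : ∀ a, ε.hom (d₁.hom a) = 0) (hε : Function.Surjective ε.hom)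
    {Z X : RMod R} (ι : Z ⟶ (tensorFunctor T).obj P₁) (π : Z ⟶ X)
    (hι : ∀ z, ((tensorFunctor T).map d₁).hom (ι.hom z) = 0)
    (hι' : ∀ y, ((tensorFunctor T).map d₁).hom y = 0 → ∃ z, ι.hom z = y)
    (hπ : Function.Surjective π.hom)
    (hπ' : ∀ z, π.hom z = 0 ↔ ∃ w, ((tensorFunctor T).map d₂).hom w = ι.hom z) :
    ∃ θ : X →+ N, IsTor t₀ e γ θ ∧ ∀ z a p, ι.hom z = tmk t₀ a → d₁.hom a = p ◃ γ →
      θ (π.hom z) = ε.hom (p ◃ e) := by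
  -- `θ` is a snake map: lift `x` to a cycle `t₀ ⊗ a`, write `d₁ a = p γ`, and take `ε (p e)`.
  have hrep : ∀ x, ∃ z a p, π.hom z = x ∧ ι.hom z = tmk t₀ a ∧ d₁.hom a = p ◃ γ := by
    intro x
    obtain ⟨z, hz⟩ := hπ x
    obtain ⟨a, ha⟩ := h.exists_tmk_eq (ι.hom z)
    obtain ⟨p, hp⟩ := (h.tmk_eq_zero_iff (d₁.hom a)).1 (by
      rw [← tensorFunctor_map_tmk, ha, hι]
      rfl)
    exact ⟨z, a, p, hz, ha.symm, hp⟩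
  have hzero : ∀ z a p, ι.hom z = tmk t₀ a → d₁.hom a = p ◃ γ → π.hom z = 0 →
      ε.hom (p ◃ e) = 0 := by
    intro z a p hz ha hπz
    obtain ⟨w, hw⟩ := (hπ' z).1 hπz
    obtain ⟨b, rfl⟩ := h.exists_tmk_eq w
    rw [tensorFunctor_map_tmk, hz] at hw
    obtain ⟨c, hc⟩ := (h.tmk_eq_iff _ _).1 hw.symm
    have hpc : p ◃ e - d₁.hom c ◃ e = 0 := by
      refine h₀ _ ?_ ?_
      · rw [act_sub, h.act_act_idem, h.act_act_idem]
      · rw [act_sub, h.act_idem_act, h.act_idem_act, ← ha, hc, map_add, hd₂, zero_add, map_act,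
          sub_self]
    rw [sub_eq_zero.1 hpc, ← map_act, hε₂]
  choose z a p hz ha hp using hrep
  have hchar : ∀ z' a' p', ι.hom z' = tmk t₀ a' → d₁.hom a' = p' ◃ γ →
      ε.hom (p (π.hom z') ◃ e) = ε.hom (p' ◃ e) := by
    intro z' a' p' hz' ha'
    rw [← sub_eq_zero, ← map_sub, ← act_sub]
    refine hzero (z (π.hom z') - z') (a (π.hom z') - a') _ ?_ ?_ ?_
    · rw [map_sub, map_sub, ha, hz']
      rfl
    · rw [map_sub, hp, ha', act_sub]
    · rw [map_sub, hz, sub_self]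
  let θ : X →+ N :=
    { toFun := fun x => ε.hom (p x ◃ e)
      map_zero' := hzero (z 0) (a 0) (p 0) (ha 0) (hp 0) (hz 0)
      map_add' := fun x y => by
        have := hchar (z x + z y) (a x + a y) (p x + p y)
          (by rw [map_add, map_add, ha, ha]; rfl) (by rw [map_add, hp, hp, act_add])
        rwa [map_add, hz, hz, act_add, map_add] at this }
  have hθ : ∀ x, θ x = ε.hom (p x ◃ e) := fun _ => rfl
  refine ⟨θ, ?_, hchar⟩
  constructor
  · rw [injective_iff_map_eq_zero]
    intro x hx
    rw [hθ] at hx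
    obtain ⟨c, hc⟩ := hε₁ _ hx
    obtain ⟨b, hb⟩ := hd₁ (a x - c ◃ γ) (by
      rw [map_sub, map_act, hc, h.act_idem_act, hp, sub_self])
    rw [← hz x]
    refine (hπ' _).2 ⟨tmk t₀ b, ?_⟩
    rw [tensorFunctor_map_tmk, hb, map_sub, h.tmk_act_eq_zero, ha]
    exact sub_zero _
  · intro x
    rw [hθ, ← map_act, h.act_act_idem]
  · intro x
    rw [hθ, ← map_act, h.act_idem_act, ← hp, hε₂]
  · intro n hne hnγ
    obtain ⟨p', rfl⟩ := hε n
    obtain ⟨a', ha'⟩ := hε₁ (p' ◃ γ) (by rw [map_act, hnγ])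
    obtain ⟨z', hz'⟩ := hι' (tmk t₀ a') (by
      rw [tensorFunctor_map_tmk, ha', h.tmk_act_eq_zero]; rfl)
    refine ⟨π.hom z', ?_⟩
    rw [hθ, hchar z' a' p' hz' ha', map_act, hne]
  · intro r s c hr x
    have := hchar (r • z x) (a x ◃ s) (p x ◃ c) (by
      rw [map_smul, ha, ← tmk_apply_left, hr.apply_eq]
      exact smul_tmk r t₀ (a x)) (by
      rw [map_act, hp, act_act, act_act, hr.comm])
    rw [map_smul, hz] at this
    rw [hθ, hθ, this, ← map_act, act_act, act_act, hr.left_fixed, hr.right_fixed]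

variable (t₀ e γ) in
omit h in
/-- `Tor₁(N, T)` as the kernel of `K ⊗_S T ⟶ P ⊗_S T`, for `0 ⟶ K ⟶ P ⟶ N ⟶ 0` exact with
`Tor₁(P, T) = 0`. -/
theorem exists_isTor_of_shortExact (h : TiltingData t₀ e γ) {S : ShortComplex (RMod (End T))}
    (hS : S.ShortExact) (h₂ : TorZero e γ S.X₂) {X : RMod R}
    (ι : X ⟶ (tensorFunctor T).obj S.X₁) (hι : Function.Injective ι.hom)
    (hι₁ : ∀ z, ((tensorFunctor T).map S.f).hom (ι.hom z) = 0)
    (hι₂ : ∀ y, ((tensorFunctor T).map S.f).hom y = 0 → ∃ z, ι.hom z = y) :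
    ∃ θ : X →+ S.X₃, IsTor t₀ e γ θ ∧ ∀ z a p, ι.hom z = tmk t₀ a → S.f.hom a = p ◃ γ →
      θ z = S.g.hom (p ◃ e) := by
  -- Injectivity of `S.f` permits `d₂ = 0`, so the homology is just the kernel.
  refine h.exists_isTor_of_exact (d₂ := (0 : S.X₁ ⟶ S.X₁)) h₂
    (fun a ha => ⟨0, (map_zero _).trans
      (hS.moduleCat_injective_f (ha.trans (map_zero S.f.hom).symm)).symm⟩)
    (fun b => map_zero S.f.hom) (fun p hp => shortExact_exists_eq hS hp)
    (fun a => g_f_apply a) hS.moduleCat_surjective_g ι (𝟙 X) hι₁ hι₂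
    (fun x => ⟨x, rfl⟩) (fun z => ?_)
  rw [Functor.map_zero]
  constructor
  · intro hz
    refine ⟨0, (map_zero _).trans ?_⟩
    change z = 0 at hz
    rw [hz, map_zero]
  · rintro ⟨w, hw⟩
    exact hι (hw.symm.trans (map_zero ι.hom).symm)

section Uniqueness

variable {X X' : RMod R} {N N' : RMod (End T)} {θ : X →+ N} {θ' : X' →+ N'}

/-- A homomorphism `N ⟶ N'` induces a homomorphism `Tor₁(N, T) ⟶ Tor₁(N', T)`. -/
theorem exists_map_of_isTor (hθ : IsTor t₀ e γ θ) (hθ' : IsTor t₀ e γ θ') (φ : N ⟶ N') :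
    ∃ f : X ⟶ X', ∀ x, θ' (f.hom x) = φ.hom (θ x) := by
  have hex : ∀ x, ∃ y, θ' y = φ.hom (θ x) := fun x =>
    hθ'.exists_eq _ (by rw [← map_act, hθ.fixed]) (by rw [← map_act, hθ.act_eq_zero, map_zero])
  choose f hf using hex
  refine ⟨ModuleCat.ofHom
    { toFun := f
      map_add' := fun x y => hθ'.injective (by rw [map_add, hf, hf, hf, map_add, map_add])
      map_smul' := fun r x => hθ'.injective ?_ }, hf⟩
  -- `R` acts on `Tor₁` through any lift `c ∈ S` of `r`, and `φ` commutes with `c`.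
  obtain ⟨s, c, hr⟩ := h.exists_liftsScalar r
  change θ' (f (r • x)) = θ' (r • f x)
  rw [hθ'.map_smul hr, hf, hf, hθ.map_smul hr, map_act]

/-- `Tor₁(N, T)` is unique up to isomorphism. -/
theorem exists_iso_of_isTor {θ' : X' →+ N} (hθ : IsTor t₀ e γ θ) (hθ' : IsTor t₀ e γ θ') :
    ∃ i : X ≅ X', ∀ x, θ' (i.hom.hom x) = θ x := by
  obtain ⟨f, hf⟩ := h.exists_map_of_isTor hθ hθ' (𝟙 N)
  obtain ⟨g, hg⟩ := h.exists_map_of_isTor hθ' hθ (𝟙 N)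
  refine ⟨⟨f, g, ?_, ?_⟩, hf⟩
  · exact ModuleCat.hom_ext (LinearMap.ext fun x => hθ.injective ((hg _).trans (hf x)))
  · exact ModuleCat.hom_ext (LinearMap.ext fun x => hθ'.injective ((hf _).trans (hg x)))

end Uniqueness

end TiltingData

-- Cycles and boundaries as elements

section HomologyElements

variable {A : Type u} [Ring A] (K : ChainComplex (RMod A) ℕ)

theorem exists_iCycles_eq {i j : ℕ} (hj : (ComplexShape.down ℕ).next i = j) {y : K.X i}
    (hy : (K.d i j).hom y = 0) : ∃ z, (K.iCycles i).hom z = y :=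
  (ShortComplex.moduleCat_exact_iff _).1
    (ShortComplex.exact_of_f_is_kernel (ShortComplex.mk (K.iCycles i) (K.d i j) (K.iCycles_d i j))
      (K.cyclesIsKernel i j hj)) y hy

theorem homologyπ_eq_zero_iff {i j : ℕ} (hi : (ComplexShape.down ℕ).prev j = i)
    (z : K.cycles j) :
    (K.homologyπ j).hom z = 0 ↔ ∃ w, (K.d i j).hom w = (K.iCycles j).hom z := by
  have hinj : Function.Injective (K.iCycles j).hom :=
    (ModuleCat.mono_iff_injective _).1 inferInstance
  have hd : ∀ w, (K.iCycles j).hom ((K.toCycles i j).hom w) = (K.d i j).hom w := fun w =>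
    congrArg (fun φ : K.X i ⟶ K.X j => φ.hom w) (K.toCycles_i i j)
  constructor
  · intro hz
    obtain ⟨w, rfl⟩ := (ShortComplex.moduleCat_exact_iff _).1
      (ShortComplex.exact_of_g_is_cokernel (ShortComplex.mk _ _ (K.toCycles_comp_homologyπ i j))
        (K.homologyIsCokernel i j hi)) z hz
    exact ⟨w, (hd w).symm⟩
  · rintro ⟨w, hw⟩
    obtain rfl : (K.toCycles i j).hom w = z := hinj ((hd w).trans hw)
    exact congrArg (fun φ : K.X i ⟶ K.homology j => φ.hom w) (K.toCycles_comp_homologyπ i j)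

end HomologyElements

-- Comparison with the derived functor `tor1Functor`

namespace TiltingData

variable {R : Type u} [Ring R] {T : RMod R} {t₀ : T} {e γ : T ⟶ T} (h : TiltingData t₀ e γ)
include h

/-- The complex `P ⊗_S T`, for a projective resolution `P` of `N`. -/
abbrev resolutionTensor {N : RMod (End T)} (P : ProjectiveResolution N) :
    ChainComplex (RMod R) ℕ :=
  ((tensorFunctor T).mapHomologicalComplex (ComplexShape.down ℕ)).obj P.complex

theorem exists_isTor_resolution {N : RMod (End T)} (P : ProjectiveResolution N) :
    ∃ θ : (resolutionTensor P).homology 1 →+ N, IsTor t₀ e γ θ ∧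
      ∀ (z : (resolutionTensor P).cycles 1) (a : P.complex.X 1) (p : P.complex.X 0),
        ((resolutionTensor P).iCycles 1).hom z = tmk t₀ a →
        (P.complex.d 1 0).hom a = p ◃ γ →
        θ (((resolutionTensor P).homologyπ 1).hom z) = (P.π.f 0).hom (p ◃ e) := by
  have hπ : Function.Surjective (P.π.f 0).hom := (ModuleCat.epi_iff_surjective _).1 inferInstance
  refine h.exists_isTor_of_exact (d₂ := P.complex.d 2 1) (d₁ := P.complex.d 1 0)
    (ε := P.π.f 0) (h.torZero_of_projective _)
    (fun a ha => (ShortComplex.moduleCat_exact_iff _).1 (P.exact_succ 0) a ha)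
    (fun b => congrArg (fun φ : P.complex.X 2 ⟶ P.complex.X 0 => φ.hom b)
      (P.complex.d_comp_d 2 1 0))
    (fun p hp => (ShortComplex.moduleCat_exact_iff _).1 P.exact₀ p hp)
    (fun a => congrArg (fun φ : P.complex.X 1 ⟶ N => φ.hom a) P.complex_d_comp_π_f_zero)
    hπ ((resolutionTensor P).iCycles 1) ((resolutionTensor P).homologyπ 1)
    (fun z => congrArg (fun φ : (resolutionTensor P).cycles 1 ⟶ (resolutionTensor P).X 0 =>
      φ.hom z) ((resolutionTensor P).iCycles_d 1 0))
    (fun y hy => exists_iCycles_eq (resolutionTensor P) (by simp) hy)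
    ((ModuleCat.epi_iff_surjective _).1 inferInstance)
    (fun z => homologyπ_eq_zero_iff (resolutionTensor P) (by simp) z)

/-- `tor1Functor` computes `Tor₁(-, T)`, naturally. -/
theorem exists_isTor_tor1Functor : ∃ θ : ∀ N : RMod (End T), (tor1Functor T).obj N →+ N,
    (∀ N, IsTor t₀ e γ (θ N)) ∧
    ∀ {N N' : RMod (End T)} (φ : N ⟶ N') (x : (tor1Functor T).obj N),
      θ N' (((tor1Functor T).map φ).hom x) = φ.hom (θ N x) := by
  choose θ hθ hchar using fun N : RMod (End T) =>
    h.exists_isTor_resolution (projectiveResolution N)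
  let i (N : RMod (End T)) := (projectiveResolution N).isoLeftDerivedObj (tensorFunctor T) 1
  refine ⟨fun N => (θ N).comp (i N).hom.hom.toAddMonoidHom, fun N => ?_, fun {N N'} φ x => ?_⟩
  · have hi : Function.Bijective (i N).hom.hom :=
      (ConcreteCategory.isIso_iff_bijective _).1 inferInstance
    exact
      { injective := (hθ N).injective.comp hi.1
        fixed := fun x => (hθ N).fixed _
        act_eq_zero := fun x => (hθ N).act_eq_zero _
        exists_eq := fun n hn hn' => by
          obtain ⟨x, hx⟩ := (hθ N).exists_eq n hn hn'
          obtain ⟨y, rfl⟩ := hi.2 x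
          exact ⟨y, hx⟩
        map_smul := fun hr x =>
          (congrArg (θ N) (_root_.map_smul (i N).hom.hom _ x)).trans ((hθ N).map_smul hr _) }
  · let P := projectiveResolution N
    let Q := projectiveResolution N'
    let ψ := ProjectiveResolution.lift φ P Q
    let Ψ := ((tensorFunctor T).mapHomologicalComplex (ComplexShape.down ℕ)).map ψ
    have hnat : ((i N').hom.hom (((tor1Functor T).map φ).hom x)) =
        (HomologicalComplex.homologyMap Ψ 1).hom ((i N).hom.hom x) :=
      congrArg (fun f : (tor1Functor T).obj N ⟶ (resolutionTensor Q).homology 1 => f.hom x)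
        (ProjectiveResolution.isoLeftDerivedObj_hom_naturality φ P Q ψ
          (ProjectiveResolution.lift_commutes_zero φ P Q) (tensorFunctor T) 1)
    change θ N' ((i N').hom.hom (((tor1Functor T).map φ).hom x)) = φ.hom (θ N ((i N).hom.hom x))
    rw [hnat]
    generalize (i N).hom.hom x = y
    obtain ⟨z, rfl⟩ := (ModuleCat.epi_iff_surjective ((resolutionTensor P).homologyπ 1)).1
      inferInstance y
    obtain ⟨a, ha⟩ := h.exists_tmk_eq (((resolutionTensor P).iCycles 1).hom z)
    obtain ⟨p, hp⟩ := (h.tmk_eq_zero_iff ((P.complex.d 1 0).hom a)).1 (by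
      rw [← tensorFunctor_map_tmk, ha]
      exact congrArg (fun φ : (resolutionTensor P).cycles 1 ⟶ (resolutionTensor P).X 0 =>
        φ.hom z) ((resolutionTensor P).iCycles_d 1 0))
    -- The chain map `ψ` carries the snake data `(z, a, p)` for `N` to snake data for `N'`.
    refine Eq.trans ?_ (congrArg φ.hom (hchar N z a p ha.symm hp).symm)
    have h₁ : (HomologicalComplex.homologyMap Ψ 1).hom (((resolutionTensor P).homologyπ 1).hom z)
        = ((resolutionTensor Q).homologyπ 1).hom ((HomologicalComplex.cyclesMap Ψ 1).hom z) :=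
      congrArg (fun f : (resolutionTensor P).cycles 1 ⟶ (resolutionTensor Q).homology 1 =>
        f.hom z) (HomologicalComplex.homologyπ_naturality Ψ 1)
    have h₂ : ((resolutionTensor Q).iCycles 1).hom ((HomologicalComplex.cyclesMap Ψ 1).hom z) =
        ((tensorFunctor T).map (ψ.f 1)).hom (((resolutionTensor P).iCycles 1).hom z) :=
      congrArg (fun f : (resolutionTensor P).cycles 1 ⟶ (resolutionTensor Q).X 1 =>
        f.hom z) (HomologicalComplex.cyclesMap_i Ψ 1)
    have h₃ : (Q.complex.d 1 0).hom ((ψ.f 1).hom a) = (ψ.f 0).hom p ◃ γ := by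
      rw [← map_act, ← hp]
      exact congrArg (fun f : P.complex.X 1 ⟶ Q.complex.X 0 => f.hom a) (ψ.comm 1 0)
    refine (congrArg (θ N') h₁).trans ((hchar N' _ ((ψ.f 1).hom a) _ ?_ h₃).trans ?_)
    · rw [← tensorFunctor_map_tmk, ha]
      exact h₂
    · rw [← map_act]
      exact congrArg (fun f : P.complex.X 0 ⟶ N' => f.hom (p ◃ e))
        (ProjectiveResolution.lift_commutes_zero φ P Q)

end TiltingData

-- Faithfulness of `Tor₁` on `𝒳`, and the cone of the unit

namespace TiltingData

variable {R : Type u} [Ring R] {T : RMod R} {t₀ : T} {e γ : T ⟶ T} (h : TiltingData t₀ e γ)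
include h

section Faithful

/-- If `φ : N ⟶ N'` kills `Tor₁(N, T)`, `N ⊗_S T = 0` and `Hom(T, Tor₁(N', T)) = 0`, then
`Tor₁(-, T)` vanishes on the image of `φ`. -/
theorem map_eq_zero_of_act_eq_zero {N N' : RMod (End T)} (hN : TensorZero γ N) {X' : RMod R}
    {θ' : X' →+ N'} (hθ' : IsTor t₀ e γ θ') (hX' : KerHomFrom T X') {φ : N ⟶ N'}
    (hφ : ∀ n, n ◃ e = n → n ◃ γ = 0 → φ.hom n = 0) {n : N} (hn : φ.hom n ◃ γ = 0) :
    φ.hom n ◃ e = 0 := by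
  -- For `L` the image of `φ`, `Tor₁(L, T) ≅ ker φ ⊗ T` is generated by `T` yet embeds in `X'`.
  -- Concretely, `t = s t₀` goes to `φ m` with `m γ = k s`, a map `T → X'` whose value at `t₀` is `φ
  -- (n e)`.
  let k := n ◃ γ
  have hk : φ.hom k = 0 := by rw [map_act, hn]
  have hex : ∀ t : T, ∃ (s : T ⟶ T) (m : N) (y : X'), s.hom t₀ = t ∧ m ◃ e = m ∧
      m ◃ γ = k ◃ s ∧ θ' y = φ.hom m := by
    intro t
    obtain ⟨s, hs⟩ := h.exists_apply_eq_self t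
    obtain ⟨m, hm⟩ := hN (k ◃ s)
    obtain ⟨y, hy⟩ := hθ'.exists_eq (φ.hom (m ◃ e))
      (by rw [← map_act, h.act_act_idem])
      (by rw [← map_act, h.act_idem_act, ← hm, map_act, hk, act_zero])
    exact ⟨s, m ◃ e, y, hs, h.act_act_idem m, by rw [h.act_idem_act, hm], hy⟩
  have hzero : ∀ (s : T ⟶ T) (m : N), s.hom t₀ = 0 → m ◃ e = m → m ◃ γ = k ◃ s →
      φ.hom m = 0 := by
    intro s m hs hme hmγ
    obtain ⟨a, rfl⟩ := h.exists_factor s hs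
    have := hφ (m - k ◃ a ◃ e) (by rw [act_sub, hme, h.act_act_idem])
      (by rw [act_sub, hmγ, h.act_idem_act, act_act k a γ, sub_self])
    rwa [map_sub, map_act, map_act, hk, act_zero, act_zero, sub_zero] at this
  choose s m y hs hme hmγ hy using hex
  have hchar : ∀ (t : T) (s' : T ⟶ T) (m' : N) (y' : X'), s'.hom t₀ = t → m' ◃ e = m' →
      m' ◃ γ = k ◃ s' → θ' y' = φ.hom m' → y t = y' := by
    intro t s' m' y' hs' hme' hmγ' hy'
    refine hθ'.injective ?_
    rw [hy, hy', ← sub_eq_zero, ← map_sub]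
    refine hzero (s t - s') _ ?_ ?_ ?_
    · rw [ModuleCat.hom_sub, LinearMap.sub_apply, hs, hs', sub_self]
    · rw [act_sub, hme, hme']
    · rw [act_sub, hmγ, hmγ', act_sub_right]
  let f : T ⟶ X' := ModuleCat.ofHom
    { toFun := y
      map_add' := fun t t' => hchar _ (s t + s t') (m t + m t') _
        (by rw [ModuleCat.hom_add, LinearMap.add_apply, hs, hs])
        (by rw [act_add, hme, hme]) (by rw [act_add, hmγ, hmγ, act_add_right])
        (by rw [map_add, map_add, hy, hy])
      map_smul' := fun r t => by
        obtain ⟨s₁, c, hr⟩ := h.exists_liftsScalar r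
        refine hchar _ (s₁ ≫ s t) (m t ◃ c) _ ?_ ?_ ?_ ?_
        · rw [ModuleCat.hom_comp, LinearMap.comp_apply, hr.apply_eq, map_smul, hs]
        · rw [act_act, hr.left_fixed]
        · rw [act_act, hr.comm, ← act_act, hmγ, act_act]
        · exact (hθ'.map_smul hr _).trans (by rw [hy, map_act]) }
  have hf : y t₀ = 0 := congrArg (fun g : T ⟶ X' => g.hom t₀) (hX' f)
  obtain ⟨y', hy'⟩ := hθ'.exists_eq (φ.hom (n ◃ e)) (by rw [← map_act, h.act_act_idem])
    (by rw [map_act, h.act_idem_act, hn])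
  rw [hchar t₀ (𝟙 T) (n ◃ e) y' rfl (h.act_act_idem n)
    (by rw [h.act_idem_act, act_id]) hy'] at hf
  rw [← map_act, ← hy', hf, map_zero]

/-- A homomorphism `φ : N ⟶ N'` that kills `Tor₁(N, T)` is zero if `N ⊗_S T = 0`, `N'` belongs
to `ℳ` and `Hom(T, Tor₁(N', T)) = 0`. -/
theorem hom_eq_zero_of_isTor {W : RMod R} (hW : IsCoseparator W) {N N' : RMod (End T)}
    (hN : TensorZero γ N) (hN' : classM T W N') {X' : RMod R}
    {θ' : X' →+ N'} (hθ' : IsTor t₀ e γ θ') (hX' : KerHomFrom T X') {φ : N ⟶ N'}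
    (hφ : ∀ n, n ◃ e = n → n ◃ γ = 0 → φ.hom n = 0) : φ = 0 := by
  let L : RMod (End T) := ModuleCat.of _ (LinearMap.range φ.hom)
  let j : L ⟶ N' := ModuleCat.ofHom (LinearMap.range φ.hom).subtype
  let q : N ⟶ L := ModuleCat.ofHom φ.hom.rangeRestrict
  have hq : Function.Surjective q.hom := LinearMap.surjective_rangeRestrict _
  -- The image of `φ` lies in `ℰ`, so it cannot embed in `N' ∈ ℳ` unless it is zero.
  have hL : classE T W L := by
    refine (h.classE_iff hW).2 ⟨fun x hx hx' => ?_, hN.of_surjective q hq⟩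
    obtain ⟨n, rfl⟩ := hq x
    have h₁ : φ.hom n ◃ γ = 0 := congrArg j.hom hx'
    have h₂ := h.map_eq_zero_of_act_eq_zero hN hθ' hX' hφ h₁
    refine Subtype.ext ((congrArg j.hom hx).symm.trans ?_)
    exact h₂
  have : φ = q ≫ j := rfl
  rw [this, (hN' L hL).1 j, Limits.comp_zero]

end Faithful

section Cone

omit h in
theorem map_tensorUnit {N N' : RMod (End T)} (f : N ⟶ N') (n : N) :
    ((homFunctor T).map ((tensorFunctor T).map f)).hom ((tensorUnit N).hom n) =
      (tensorUnit N').hom (f.hom n) :=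
  ev_ext fun t => tensorFunctor_map_tmk f t n

/-- The map `K ⟶ P × Hom(T, K ⊗_S T)` given by `f : K ⟶ P` and the unit. -/
abbrev coneIncl {K P : RMod (End T)} (f : K ⟶ P) :
    K →ₗ[(End T)ᵐᵒᵖ] P × (homFunctor T).obj ((tensorFunctor T).obj K) :=
  f.hom.prod (tensorUnit K).hom

/-- The map `P × Hom(T, K ⊗_S T) ⟶ Hom(T, P ⊗_S T)` given by the unit and `f : K ⟶ P`. -/
abbrev coneProj {K P : RMod (End T)} (f : K ⟶ P) :
    (P × (homFunctor T).obj ((tensorFunctor T).obj K)) →ₗ[(End T)ᵐᵒᵖ]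
      (homFunctor T).obj ((tensorFunctor T).obj P) :=
  (tensorUnit P).hom.coprod (-((homFunctor T).map ((tensorFunctor T).map f)).hom)

omit h in
theorem coneProj_coneIncl {K P : RMod (End T)} (f : K ⟶ P) (k : K) :
    coneIncl f k ∈ LinearMap.ker (coneProj f) := by
  rw [LinearMap.mem_ker, LinearMap.prod_apply, LinearMap.coprod_apply]
  change (tensorUnit P).hom (f.hom k) + -(((homFunctor T).map ((tensorFunctor T).map f)).hom
    ((tensorUnit K).hom k)) = 0
  rw [map_tensorUnit, add_neg_cancel]

omit h in
theorem mem_ker_coneProj {K P : RMod (End T)} (f : K ⟶ P) (p : P)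
    (x : (homFunctor T).obj ((tensorFunctor T).obj K)) :
    (p, x) ∈ LinearMap.ker (coneProj f) ↔ (tensorUnit P).hom p =
      ((homFunctor T).map ((tensorFunctor T).map f)).hom x := by
  rw [LinearMap.mem_ker, LinearMap.coprod_apply, LinearMap.neg_apply, ← sub_eq_add_neg,
    sub_eq_zero]

/-- The middle homology of `K ⟶ P × Hom(T, K ⊗_S T) ⟶ Hom(T, P ⊗_S T)`. -/
abbrev coneHomology {K P : RMod (End T)} (f : K ⟶ P) : RMod (End T) :=
  ModuleCat.of _ (LinearMap.ker (coneProj f) ⧸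
    LinearMap.range ((coneIncl f).codRestrict _ (coneProj_coneIncl f)))

/-- The unit `η` becomes invertible after tensoring with `T`, so its cone should be invisible to
`T`. For `Tor₁`: if `(p γ, x γ) = (f k, η k)`, then `k = k' γ` and `k' e` maps to `(p e, x e)`. For
the tensor product: subtracting the image of some `k` makes both coordinates multiples of `γ`. -/
theorem classE_coneHomology {W : RMod R} (hW : IsCoseparator W) {K P : RMod (End T)} (f : K ⟶ P)
    (hP : TorZero e γ P) : classE T W (coneHomology f) := by
  have hmk (z : LinearMap.ker (coneProj f)) :
      (Submodule.Quotient.mk z : coneHomology f) = 0 ↔ ∃ k, coneIncl f k = z := by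
    refine (Submodule.Quotient.mk_eq_zero _).trans (exists_congr fun k => ?_)
    exact Subtype.ext_iff
  have hact (z : LinearMap.ker (coneProj f)) (s : T ⟶ T) :
      act (N := coneHomology f) (Submodule.Quotient.mk z) s =
        Submodule.Quotient.mk ((op s : (End T)ᵐᵒᵖ) • z) := rfl
  refine (h.classE_iff hW).2 ⟨fun z hz hz' => ?_, fun z => ?_⟩
  · obtain ⟨⟨⟨p, x⟩, hpx⟩, rfl⟩ := Submodule.Quotient.mk_surjective _ z
    rw [hact, hmk] at hz'
    obtain ⟨k, hk⟩ := hz'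
    have h₁ : f.hom k = p ◃ γ := congrArg Prod.fst hk
    have h₂ : (tensorUnit K).hom k = x ◃ γ := congrArg Prod.snd hk
    obtain ⟨k, rfl⟩ := h.exists_of_tensorUnit_eq_act h₂
    rw [map_act] at h₁ h₂
    rw [← hz, hact, hmk]
    refine ⟨k ◃ e, Prod.ext ?_ ?_⟩
    · change f.hom (k ◃ e) = p ◃ e
      rw [map_act, ← sub_eq_zero, ← act_sub]
      exact hP _ (h.act_act_idem _) (by rw [h.act_idem_act, act_sub, h₁, sub_self])
    · change (tensorUnit K).hom (k ◃ e) = x ◃ e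
      rw [map_act, h.hom_eq_of_act_eq h₂]
  · obtain ⟨⟨⟨p, x⟩, hpx⟩, rfl⟩ := Submodule.Quotient.mk_surjective _ z
    rw [mem_ker_coneProj] at hpx
    obtain ⟨k, x', rfl⟩ := h.exists_tensorUnit_add x
    rw [map_add, map_tensorUnit, map_act, ← sub_eq_iff_eq_add', ← map_sub] at hpx
    obtain ⟨p', hp'⟩ := h.exists_of_tensorUnit_eq_act hpx
    rw [hp', map_act] at hpx
    have hmem : (p' ◃ e, x' ◃ e) ∈ LinearMap.ker (coneProj f) := by
      rw [mem_ker_coneProj, map_act, map_act, h.hom_eq_of_act_eq hpx]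
    refine ⟨Submodule.Quotient.mk ⟨_, hmem⟩, ?_⟩
    rw [hact, ← sub_eq_zero]
    refine (hmk (_ - _)).2 ⟨k, Prod.ext ?_ ?_⟩
    · change f.hom k = p - p' ◃ e ◃ γ
      rw [h.act_idem_act, ← hp', sub_sub_cancel]
    · change (tensorUnit K).hom k = (tensorUnit K).hom k + x' ◃ γ - x' ◃ e ◃ γ
      rw [h.act_idem_act, add_sub_cancel_right]

end Cone

end TiltingData

-- The second equivalence

namespace TiltingData

variable {R : Type u} [Ring R] {T : RMod R} {t₀ : T} {e γ : T ⟶ T} (h : TiltingData t₀ e γ)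
include h

section Counit

variable {S : ShortComplex (RMod (End T))} (hS : S.ShortExact) (h₂ : TorZero e γ S.X₂)
include h₂

/-- If `X₃` belongs to `ℳ` and `x : Hom(T, X₁ ⊗_S T)` has the same image in
`Hom(T, X₂ ⊗_S T)` as `p : X₂`, then the image of `p` in `X₃` is zero. -/
theorem g_eq_zero_of_tensorUnit_eq {W : RMod R} (hW : IsCoseparator W) (h₃ : classM T W S.X₃)
    {p : S.X₂} {x : (homFunctor T).obj ((tensorFunctor T).obj S.X₁)}
    (hpx : (tensorUnit S.X₂).hom p = ((homFunctor T).map ((tensorFunctor T).map S.f)).hom x) :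
    S.g.hom p = 0 := by
  -- Projecting to `X₂` and applying `g` descends to the cone homology: a map from `ℰ` to `ℳ`, hence
  -- zero.
  let q : coneHomology S.f ⟶ S.X₃ := ModuleCat.ofHom <| Submodule.liftQ _
    (S.g.hom ∘ₗ LinearMap.fst _ _ _ ∘ₗ (LinearMap.ker (coneProj S.f)).subtype) (by
      rintro _ ⟨k, rfl⟩
      exact g_f_apply k)
  have hq : q = 0 := (h₃ _ (h.classE_coneHomology hW S.f h₂)).1 q
  exact congrArg (fun φ : coneHomology S.f ⟶ S.X₃ =>
    φ.hom (Submodule.Quotient.mk ⟨(p, x), (mem_ker_coneProj S.f p x).2 hpx⟩)) hq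

include hS

/-- If `0 ⟶ X ⟶ K ⊗_S T ⟶ P ⊗_S T ⟶ 0` is exact, where `0 ⟶ K ⟶ P ⟶ N ⟶ 0` is exact with
`N` in `ℳ`, then `Hom(T, X) = 0`. -/
theorem kerHomFrom_of_shortExact {W : RMod R} (hW : IsCoseparator W) (h₃ : classM T W S.X₃)
    {X : RMod R} (ι : X ⟶ (tensorFunctor T).obj S.X₁) (hι : ι ≫ (tensorFunctor T).map S.f = 0)
    (hE : (ShortComplex.mk ι ((tensorFunctor T).map S.f) hι).ShortExact) : KerHomFrom T X := by
  let H := (homFunctor T).obj X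
  let j : H ⟶ (homFunctor T).obj ((tensorFunctor T).obj S.X₁) := (homFunctor T).map ι
  have hj : Function.Injective j.hom := homFunctor_map_f_injective hE
  have hjβ (f : H) : ((homFunctor T).map ((tensorFunctor T).map S.f)).hom (j.hom f) = 0 :=
    ev_ext fun t => congrArg
      (fun φ : X ⟶ (tensorFunctor T).obj S.X₂ => φ.hom (ev f t)) hι
  -- The class of `(0, j f)` is `(p, x) γ` with `p = f₁ k` for `f₁ = S.f`; correcting `x` by `η k`
  -- lands in `H` and divides `f` by `γ`.
  have hH : TensorZero γ H := by
    intro f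
    obtain ⟨-, hG⟩ := (h.classE_iff hW).1 (h.classE_coneHomology hW S.f h₂)
    obtain ⟨z, hz⟩ := hG (Submodule.Quotient.mk ⟨(0, j.hom f),
      (mem_ker_coneProj S.f _ _).2 (by rw [map_zero, hjβ])⟩)
    obtain ⟨⟨⟨p, x⟩, hpx⟩, rfl⟩ := Submodule.Quotient.mk_surjective _ z
    rw [mem_ker_coneProj] at hpx
    obtain ⟨k, rfl⟩ := shortExact_exists_eq hS (h.g_eq_zero_of_tensorUnit_eq h₂ hW h₃ hpx)
    obtain ⟨k', hk'⟩ := (Submodule.Quotient.eq _).1 hz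
    have h₁ : S.f.hom k' = 0 - S.f.hom k ◃ γ := congrArg (fun w => w.1.1) hk'
    have h₂ : (tensorUnit S.X₁).hom k' = j.hom f - x ◃ γ := congrArg (fun w => w.1.2) hk'
    obtain ⟨f', hf'⟩ : ∃ f' : H, j.hom f' = x - (tensorUnit S.X₁).hom k :=
      exists_eq_of_homFunctor_map_g_eq_zero hE (f := x - (tensorUnit S.X₁).hom k) (by
        refine (map_sub _ _ _).trans (sub_eq_zero.2 ?_)
        exact hpx.symm.trans (map_tensorUnit S.f k).symm)
    refine ⟨f', hj ?_⟩
    have hk0 : k' = -(k ◃ γ) := hS.moduleCat_injective_f (by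
      change S.f.hom k' = S.f.hom (-(k ◃ γ))
      rw [h₁, map_neg, map_act, zero_sub])
    rw [map_act, hf', act_sub, ← map_act, sub_eq_iff_eq_add.1 h₂.symm, hk0, map_neg]
    abel
  intro f
  have hid : 𝟙 H = 0 := h.hom_eq_zero hH (𝟙 H)
  exact congrArg (fun φ : H ⟶ H => φ.hom (ofHom f)) hid

/-- If `0 ⟶ X ⟶ K ⊗_S T ⟶ P ⊗_S T ⟶ 0` is exact, where `0 ⟶ K ⟶ P ⟶ N ⟶ 0` is exact with
`N` in `ℳ`, then `N ≅ Ext¹(T, X)`. -/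
theorem nonempty_iso_ext {W : RMod R} (hW : IsCoseparator W) (h₃ : classM T W S.X₃)
    {X : RMod R} (ι : X ⟶ (tensorFunctor T).obj S.X₁) (hι : ι ≫ (tensorFunctor T).map S.f = 0)
    (hE : (ShortComplex.mk ι ((tensorFunctor T).map S.f) hι).ShortExact) :
    Nonempty ((ext1Functor T).obj X ≅ S.X₃) := by
  have hX := h.kerHomFrom_of_shortExact hS h₂ hW h₃ ι hι hE
  let δ : (homFunctor T).obj ((tensorFunctor T).obj S.X₂) ⟶ (ext1Functor T).obj X :=
    homConnecting T hE
  have hδ : Function.Surjective δ.hom :=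
    homConnecting_surjective hE (h.ext_subsingleton (gen_tensor S.X₁))
  have hδ₀ : ∀ x, δ.hom (((homFunctor T).map ((tensorFunctor T).map S.f)).hom x) = 0 :=
    homConnecting_map_g hE
  have hδ₁ : ∀ y, δ.hom y = 0 →
      ∃ x, ((homFunctor T).map ((tensorFunctor T).map S.f)).hom x = y :=
    fun _ => exists_eq_of_homConnecting_eq_zero hE
  have hη : S.f ≫ tensorUnit S.X₂ ≫ δ = 0 := ModuleCat.hom_ext (LinearMap.ext fun k => by
    change δ.hom ((tensorUnit S.X₂).hom (S.f.hom k)) = 0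
    rw [← map_tensorUnit, hδ₀])
  have := hS.epi_g
  -- The comparison map: apply the unit to a lift in `X₂`, then the connecting map.
  let u : S.X₃ ⟶ (ext1Functor T).obj X := hS.exact.desc _ hη
  have hu (p : S.X₂) : u.hom (S.g.hom p) = δ.hom ((tensorUnit S.X₂).hom p) :=
    congrArg (fun φ : S.X₂ ⟶ (ext1Functor T).obj X => φ.hom p) (hS.exact.g_desc _ hη)
  have hinj : Function.Injective u.hom := by
    rw [injective_iff_map_eq_zero]
    intro n hn
    obtain ⟨p, rfl⟩ := hS.moduleCat_surjective_g n
    obtain ⟨x, hx⟩ := hδ₁ _ ((hu p).symm.trans hn)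
    exact h.g_eq_zero_of_tensorUnit_eq h₂ hW h₃ hx.symm
  have hsurj : Function.Surjective u.hom := by
    refine h.surjective_of_cokernel_classE hW u hinj h₃
      (fun C φ hC => (h.classM_ext hW hX C hC).1 φ) (fun x hxe ⟨n, hn⟩ => ?_) (fun x => ?_)
    · obtain ⟨y, rfl⟩ := hδ x
      obtain ⟨p, rfl⟩ := hS.moduleCat_surjective_g n
      replace hn : δ.hom y ◃ γ = δ.hom ((tensorUnit S.X₂).hom p) := hn.trans (hu p)
      obtain ⟨x, hx⟩ := hδ₁ (y ◃ γ - (tensorUnit S.X₂).hom p) (by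
        rw [map_sub, map_act, hn, sub_self])
      obtain ⟨k, x', rfl⟩ := h.exists_tensorUnit_add x
      rw [map_add, map_tensorUnit, map_act] at hx
      have hp : (tensorUnit S.X₂).hom (p + S.f.hom k) =
          (y - ((homFunctor T).map ((tensorFunctor T).map S.f)).hom x') ◃ γ := by
        rw [map_add, act_sub, eq_sub_iff_add_eq, add_assoc, hx, add_sub_cancel]
      obtain ⟨p', hp'⟩ := h.exists_of_tensorUnit_eq_act hp
      rw [hp', map_act] at hp
      refine ⟨S.g.hom (p' ◃ e), ?_⟩
      rw [hu, map_act, h.hom_eq_of_act_eq hp, map_act, map_sub, hδ₀, sub_zero, hxe]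
    · obtain ⟨y, rfl⟩ := hδ x
      obtain ⟨p, y', rfl⟩ := h.exists_tensorUnit_add y
      exact ⟨S.g.hom p, δ.hom y', by rw [map_add, hu, map_act]⟩
  have : IsIso u := (ConcreteCategory.isIso_iff_bijective _).2 ⟨hinj, hsurj⟩
  exact ⟨(asIso u).symm⟩

end Counit

/-- An object `N` of `𝒳` is isomorphic to `Ext¹(T, X)` for `X = Tor₁(N, T)`, and
`Hom(T, X) = 0`. -/
theorem exists_isTor_iso_ext {W : RMod R} (hW : IsCoseparator W) {N : RMod (End T)}
    (hN : classX T W N) : ∃ (X : RMod R) (θ : X →+ N), IsTor t₀ e γ θ ∧ KerHomFrom T X ∧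
      Nonempty ((ext1Functor T).obj X ≅ N) := by
  have hS := projectivePresentation_shortExact N
  have h₂ := h.torZero_of_projective (projectivePresentation N).X₂
  let f := (tensorFunctor T).map (projectivePresentation N).f
  have hf : Epi f := (ModuleCat.epi_iff_surjective f).2
    (h.surjective_tensor_map hS (h.tensorZero_of_kerHomTo hW hN.1))
  have hE : (ShortComplex.mk (kernel.ι f) f (kernel.condition f)).ShortExact :=
    { exact := ShortComplex.exact_kernel f }
  obtain ⟨θ, hθ, -⟩ := exists_isTor_of_shortExact t₀ e γ h hS h₂ (kernel.ι f)
    hE.moduleCat_injective_f (fun z => g_f_apply (S := ShortComplex.mk _ f (kernel.condition f)) z)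
    (fun y hy => shortExact_exists_eq hE hy)
  exact ⟨kernel f, θ, hθ, h.kerHomFrom_of_shortExact hS h₂ hW hN.2 _ _ hE,
    h.nonempty_iso_ext hS h₂ hW hN.2 _ _ hE⟩

theorem inverseEquivalences_ext_tor {W : RMod R} (hW : IsCoseparator W) :
    InverseEquivalences (KerHomFrom T) (classX T W) (ext1Functor T) (tor1Functor T) := by
  obtain ⟨δ, hδ, hδn⟩ := h.exists_isTor_ext
  obtain ⟨θ, hθ, hθn⟩ := h.exists_isTor_tor1Functor
  -- `δ` and `θ` both compute `Tor₁(Ext¹(T, X), T)`, so uniqueness supplies the unit isomorphism.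
  choose i hi using fun (X : RMod R) (hX : KerHomFrom T X) =>
    h.exists_iso_of_isTor (hδ X hX) (hθ ((ext1Functor T).obj X))
  have htor (N : RMod (End T)) (hN : classX T W N) : KerHomFrom T ((tor1Functor T).obj N) := by
    obtain ⟨X, θ', hθ', hX, -⟩ := h.exists_isTor_iso_ext hW hN
    obtain ⟨j, -⟩ := h.exists_iso_of_isTor (hθ N) hθ'
    intro f
    rw [← cancel_mono j.hom, hX (f ≫ j.hom), Limits.zero_comp]
  refine inverseEquivalences_of_faithful
    (fun X hX => ⟨h.hom_eq_zero h.ext_eq_act, h.classM_ext hW hX⟩) htor i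
    (fun {X X'} hX hX' f => ?_) (fun N hN => ?_) (fun {N N'} hN hN' f g hfg => ?_)
  · refine ModuleCat.hom_ext (LinearMap.ext fun x => (hθ _).injective ?_)
    change θ _ ((i X' hX').hom.hom (f.hom x)) =
      θ _ (((tor1Functor T).map ((ext1Functor T).map f)).hom ((i X hX).hom.hom x))
    rw [hi, hδn, hθn, hi]
  · obtain ⟨X, -, -, hX, hXN⟩ := h.exists_isTor_iso_ext hW hN
    exact ⟨X, hX, hXN⟩
  · rw [← sub_eq_zero]
    refine h.hom_eq_zero_of_isTor hW (h.tensorZero_of_kerHomTo hW hN.1) hN'.2 (hθ N')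
      (htor N' hN') fun n hn hn' => ?_
    obtain ⟨x, rfl⟩ := (hθ N).exists_eq n hn hn'
    rw [ModuleCat.hom_sub, LinearMap.sub_apply, ← hθn, ← hθn, hfg, sub_self]

end TiltingData

end BrennerButler

end

theorem theoremT {R : Type u} [Ring R] (T : BrennerButler.RMod R)
    (hT : BrennerButler.IsOneTilting T) (hN : BrennerButler.IsNormalized T)
    (W : BrennerButler.RMod R) (hW : Injective W) (hW' : IsCoseparator W) :
    BrennerButler.InverseEquivalences
      (BrennerButler.Gen T) (BrennerButler.classY T W)
      (BrennerButler.homFunctor T) (BrennerButler.tensorFunctor T) ∧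
    BrennerButler.InverseEquivalences
      (BrennerButler.KerHomFrom T) (BrennerButler.classX T W)
      (BrennerButler.ext1Functor T) (BrennerButler.tor1Functor T) := by
  obtain ⟨t₀, e, γ, h⟩ := BrennerButler.exists_tiltingData hT hN
  exact ⟨h.inverseEquivalences_hom_tensor hW', h.inverseEquivalences_ext_tor hW'⟩
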